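/- Let $G$ be a finite graph with graph distance $d$ and let $xy$ be an edge of $G$. For $0\le\alpha<1$ let $m_x^\alpha$ be the probability distribution with mass $\alpha$ at $x$ and mass $(1-\alpha)/d_x$ at each of the $d_x$ neighbours of $x$; let $W(m_1,m_2)=\sup_f\sum_v f(v)\,[m_1(v)-m_2(v)]$, the supremum over all $f$ with $|f(u)-f(v)|\le d(u,v)$ for all $u,v$ (with $d(u,v)=\infty$ if $u,v$ lie in different components); let $$\kappa_\alpha(x,y)=1-\frac{W(m_x^\alpha,m_y^\alpha)}{d(x,y)},\qquad \kappa(x,y)=\lim_{\alpha\to1^-}\frac{\kappa_\alpha(x,y)}{1-\alpha}.$$ Let $G(n,p)$ be the random graph on $n$ vertices in which each pair of vertices is an edge independently with probability $p=p(n)\in[0,1]$. We say that a property of the curvature $\kappa(x,y)$ of an edge $xy$ of $G(n,p)$ holds almost surely if, as $n\to\infty$, the probability tends to $1$ that it holds simultaneously for all edges $xy$ of $G(n,p)$, and also, for a fixed pair $x\ne y$ of vertices, the conditional probability that it holds for $xy$, given that $xy$ is an edge, tends to $1$. We write $a\ll b$ for $a(n)/b(n)\to0$. **Theorem** (Y.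 Lin, L. Y. Lu, S. T. Yau). The limit $\kappa(x,y)$ exists and the following hold for every edge $xy$ of $G(n,p)$; the constants in the symbols $O$ are absolute, and the inequalities between $p$ and $n$ are required for all large $n$. 1. If $p\ge\sqrt[3]{(\ln n)/n}$, then almost surely $\kappa(x,y)=p+O\left(\sqrt{\frac{\ln n}{np}}\right)$. In particular, if $p\gg\sqrt[3]{(\ln n)/n}$, then almost surely $\kappa(x,y)=(1+o(1))p$. 2. If $\sqrt[3]{(\ln n)/n}>p\ge2\sqrt{(\ln n)/n}$, then almost surely $\kappa(x,y)=O\left(\frac{\ln n}{np^2}\right)$. 3. If $1/\sqrt n\gg p\gg\sqrt[3]{(\ln n)/n^2}$, then almost surely $\kappa(x,y)=-1+O(np^2)+O\left(\frac{\ln n}{n^2p^3}\right)$. 4. If $\sqrt[3]{1/n^2}\gg p\gg\frac{\ln n}{n}$, then almost surely $\kappa(x,y)=-2+O(n^2p^3)+O\left(\sqrt{\frac{\ln n}{np}}\right)$. -/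

import Mathlib

open Filter Topology MeasureTheory ProbabilityTheory Asymptotics

noncomputable section

namespace GraphCurvature

/-- `f` is `1`-Lipschitz for the graph distance. Vertices in different components are at infinite
distance (Mathlib's `SimpleGraph.dist` is `0` there), so they impose no condition. -/
def IsOneLipschitz {V : Type*} (G : SimpleGraph V) (f : V → ℝ) : Prop :=
  ∀ u v : V, G.Reachable u v → |f u - f v| ≤ (G.dist u v : ℝ)

/-- The transportation distance
`W(m₁, m₂) = sup { ∑ v, f v * (m₁ v - m₂ v) | f is 1-Lipschitz }`. -/
def transportDist {V : Type*} [Fintype V] (G : SimpleGraph V) (m₁ m₂ : V → ℝ) : ℝ :=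
  sSup {r : ℝ | ∃ f : V → ℝ, IsOneLipschitz G f ∧ r = ∑ v, f v * (m₁ v - m₂ v)}

open scoped Classical in
/-- The distribution with mass `α` at `x` and mass `(1 - α) / d_x` at each neighbour of `x`. -/
def lazyWalk {V : Type*} [Fintype V] (G : SimpleGraph V) (α : ℝ) (x v : V) : ℝ :=
  if v = x then α else if G.Adj x v then (1 - α) / (G.degree x : ℝ) else 0

/-- The `α`-Ricci curvature `κ_α(x, y) = 1 - W(m_x^α, m_y^α) / d(x, y)`. -/
def alphaCurvature {V : Type*} [Fintype V] (G : SimpleGraph V) (α : ℝ) (x y : V) : ℝ :=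
  1 - transportDist G (lazyWalk G α x) (lazyWalk G α y) / (G.dist x y : ℝ)

/-- `κ(x, y) = k`: the limit of `κ_α(x, y) / (1 - α)` as `α → 1` from below exists and is `k`. -/
def HasRicciCurvature {V : Type*} [Fintype V] (G : SimpleGraph V) (x y : V) (k : ℝ) : Prop :=
  Tendsto (fun α : ℝ => alphaCurvature G α x y / (1 - α)) (𝓝[<] 1) (𝓝 k)

/-- The set of graphs on `n` vertices for which the curvature `κ(x, y)` exists and satisfies `Q`. -/
def curvatureEvent {n : ℕ} (Q : ℝ → Prop) (x y : Fin n) : Set (SimpleGraph (Fin n)) :=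
  {G | ∃ k : ℝ, HasRicciCurvature G x y k ∧ Q k}

/-- The curvature `k` of an edge `xy` of the random graph `G(n, p n)` almost surely satisfies
`Q n k`:
* with probability tending to `1` this holds for all edges `xy` of the graph simultaneously;
* for a given pair `x ≠ y`, the conditional probability of this, given that `xy` is an edge, tends
  to `1` (uniformly in the pair, though by symmetry it does not depend on the pair). -/
def EdgeCurvatureAlmostSurely (p : ℕ → unitInterval) (Q : ℕ → ℝ → Prop) : Prop :=
  Tendsto (fun n : ℕ => (SimpleGraph.binomialRandom (Fin n) (p n)).real
      {G | ∀ x y : Fin n, G.Adj x y → G ∈ curvatureEvent (Q n) x y}) atTop (𝓝 1) ∧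
  ∀ ε : ℝ, 0 < ε → ∀ᶠ n : ℕ in atTop, ∀ x y : Fin n, x ≠ y →
    1 - ε ≤ (cond (SimpleGraph.binomialRandom (Fin n) (p n)) {G | G.Adj x y}).real
      (curvatureEvent (Q n) x y)

end GraphCurvature

end

/-!
The proof separates a deterministic estimate for the curvature of an edge from the concentration of
a few counting variables of the random graph.

Write `A f v` for the average of `f` over the neighbours of `v`. For an edge `xy`, the quotient
`κ_α / (1 - α)` is an infimum over `1`-Lipschitz functions of quantities that are monotone in `α`,
so the limit exists. It is bounded above by `1 - (A f x - A f y)` for each `1`-Lipschitz `f` with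
`f x - f y = 1`, and below by any bound valid for all `1`-Lipschitz `f`
(`exists_hasRicciCurvature`).

Upper bounds come from explicit test functions. Their error is the number of neighbours of `x`
within distance `1`, `2` or `3` of `y` in `G - x`, which counts the triangles, squares and
pentagons through `xy` (`exists_test_triangles`, `exists_test_squares`, `exists_test_pentagons`).
Lower bounds need no matching theorem: if any two disjoint sets of `s` vertices contain a pair at
distance at most `r`, then apart from `s` points on each side the values of `f` on the two
neighbourhoods are separated by a single threshold, up to `r` (`exists_threshold`,
`neighborAvg_sub_le_of_hole`). With `r = 1`, after discarding the common neighbours, this gives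
`κ ≥ p - …`, with `r = 2` it gives `κ ≥ -1 - …`, and `κ ≥ -2` always holds.

On the random side, the neighbourhood of `x` is independent of `G - x`, so the number of neighbours
of `x` in any set determined by `G - x`, in particular in a ball around `y`, deviates from its
mean by `O(√(n p ln n))` with polynomially small probability (`neighbor_deviation`). A union bound
over pairs of `s`-sets gives the expansion, with `s` of order `ln n / p` for edges
(`not_edgeExpanding_le`) and `ln n / (n p²)` for paths of length two (`not_pathExpanding_le`).
Relative to the degree `n p` the errors are `√(ln n / (n p))`, `ln n / (n p²)` and
`ln n / (n² p³)`, and the regimes differ only in which of them dominates. Every bad event has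
probability `O(n ^ (-5))`, which survives both the sum over all pairs and the division by `p` in the
conditional probability (`edgeCurvatureAlmostSurely_of_badEdge`).
-/

namespace GraphCurvature

/-! ### Curvature of an edge as an infimum over Lipschitz functions -/

open scoped Classical in
/-- The average of `f` over the neighbours of `v`. -/
noncomputable def neighborAvg {V : Type*} [Fintype V] (G : SimpleGraph V) (f : V → ℝ) (v : V) : ℝ :=
  (∑ u ∈ G.neighborFinset v, f u) / (G.degree v : ℝ)

section Deterministic

open scoped Classical

variable {V : Type*} {G : SimpleGraph V} {x y : V} {f : V → ℝ}

lemma isOneLipschitz_of_adj (h : ∀ u v, G.Adj u v → f u ≤ f v + 1) : IsOneLipschitz G f := by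
  have key : ∀ u v (w : G.Walk u v), f u ≤ f v + w.length := by
    intro u v w
    induction w with
    | nil => simp
    | cons hadj w ih =>
      have := h _ _ hadj
      push_cast [SimpleGraph.Walk.length_cons]
      linarith
  intro u v huv
  obtain ⟨w, hw⟩ := huv.exists_walk_length_eq_dist
  have h1 := key u v w
  have h2 := key v u w.reverse
  rw [SimpleGraph.Walk.length_reverse] at h2
  rw [← hw, abs_le]
  constructor <;> linarith

lemma IsOneLipschitz.abs_sub_le_one (hf : IsOneLipschitz G f) (h : G.Adj x y) :
    |f x - f y| ≤ 1 := by
  have := hf x y h.reachable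
  rwa [SimpleGraph.dist_eq_one_iff_adj.2 h, Nat.cast_one] at this

variable [Fintype V]

lemma degree_pos_real (h : G.Adj x y) : (0 : ℝ) < G.degree x := by
  have := (G.degree_pos_iff_exists_adj x).2 ⟨y, h⟩
  exact_mod_cast this

lemma neighborAvg_le (h : G.Adj x y) {b : ℝ} (hb : ∀ u, G.Adj x u → f u ≤ b) :
    neighborAvg G f x ≤ b := by
  have hd := degree_pos_real h
  rw [neighborAvg, div_le_iff₀ hd]
  have := Finset.sum_le_card_nsmul (G.neighborFinset x) f b (by simpa using hb)
  rw [nsmul_eq_mul, SimpleGraph.card_neighborFinset_eq_degree] at this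
  linarith

lemma le_neighborAvg (h : G.Adj x y) {b : ℝ} (hb : ∀ u, G.Adj x u → b ≤ f u) :
    b ≤ neighborAvg G f x := by
  have hd := degree_pos_real h
  rw [neighborAvg, le_div_iff₀ hd]
  have := Finset.card_nsmul_le_sum (G.neighborFinset x) f b (by simpa using hb)
  rw [nsmul_eq_mul, SimpleGraph.card_neighborFinset_eq_degree] at this
  linarith

lemma neighborAvg_sub_const (h : G.Adj x y) (a : ℝ) :
    neighborAvg G (fun v => f v - a) x = neighborAvg G f x - a := by
  have hd := degree_pos_real h
  rw [neighborAvg, neighborAvg, Finset.sum_sub_distrib, Finset.sum_const, nsmul_eq_mul,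
    SimpleGraph.card_neighborFinset_eq_degree]
  field_simp

/-- Neighbouring averages of a `1`-Lipschitz function differ by at most `3`. -/
lemma IsOneLipschitz.neighborAvg_sub_le_three (hf : IsOneLipschitz G f) (h : G.Adj x y) :
    neighborAvg G f x - neighborAvg G f y ≤ 3 := by
  have h1 : neighborAvg G f x ≤ f x + 1 := neighborAvg_le h fun u hu => by
    have := abs_le.1 (hf.abs_sub_le_one hu); linarith
  have h2 : f y - 1 ≤ neighborAvg G f y := le_neighborAvg h.symm fun u hu => by
    have := abs_le.1 (hf.abs_sub_le_one hu); linarith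
  have := abs_le.1 (hf.abs_sub_le_one h)
  linarith

lemma sum_mul_lazyWalk (f : V → ℝ) (α : ℝ) (x : V) :
    ∑ v, f v * lazyWalk G α x v = α * f x + (1 - α) * neighborAvg G f x := by
  have : ∀ v, f v * lazyWalk G α x v = (if v = x then α * f x else 0) +
      (if G.Adj x v then (1 - α) / (G.degree x : ℝ) * f v else 0) := by
    intro v
    unfold lazyWalk
    by_cases hv : v = x
    · subst hv; simp [mul_comm]
    · by_cases ha : G.Adj x v <;> simp [hv, ha, mul_comm]
  simp_rw [this]
  rw [Finset.sum_add_distrib, Finset.sum_ite_eq' Finset.univ x, ← Finset.sum_filter,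
    neighborAvg, ← Finset.mul_sum]
  have h2 : Finset.univ.filter (fun v => G.Adj x v) = G.neighborFinset x := by ext; simp
  rw [h2]
  simp only [Finset.mem_univ, if_true]
  ring

/-- The Ricci curvature of an edge `xy` exists, it is at most `1 - (A f x - A f y)` for every
`1`-Lipschitz `f` with `f x - f y = 1`, where `A f` is the average over neighbours, and it is at
least every uniform lower bound of `1 - (A f x - A f y)` over all `1`-Lipschitz `f`.
Indeed `κ_α / (1 - α)` is the infimum over `f` of
`(1 - α (f x - f y)) / (1 - α) - (A f x - A f y)`, in which every term is monotone in `α`. -/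
theorem exists_hasRicciCurvature (h : G.Adj x y) :
    ∃ k, HasRicciCurvature G x y k ∧
      (∀ f, IsOneLipschitz G f → f x - f y = 1 →
        k ≤ 1 - (neighborAvg G f x - neighborAvg G f y)) ∧
      (∀ L, (∀ f, IsOneLipschitz G f → L ≤ 1 - (neighborAvg G f x - neighborAvg G f y)) →
        L ≤ k) := by
  have hxy : x ≠ y := h.ne
  set D : (V → ℝ) → ℝ := fun f => neighborAvg G f x - neighborAvg G f y with hD
  set val : ℝ → (V → ℝ) → ℝ := fun α f => α * (f x - f y) + (1 - α) * D f with hval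
  set S : ℝ → Set ℝ := fun α => {r | ∃ f, IsOneLipschitz G f ∧ r = val α f} with hS
  have hcurv : ∀ α, alphaCurvature G α x y = 1 - sSup (S α) := by
    intro α
    have hs : ∀ f : V → ℝ, ∑ v, f v * (lazyWalk G α x v - lazyWalk G α y v) = val α f := by
      intro f
      simp_rw [mul_sub]
      rw [Finset.sum_sub_distrib, sum_mul_lazyWalk, sum_mul_lazyWalk]
      simp only [hval, hD]
      ring
    rw [alphaCurvature, transportDist, SimpleGraph.dist_eq_one_iff_adj.2 h]
    simp only [hs, Nat.cast_one, div_one]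
    rfl
  have hD3 : ∀ f, IsOneLipschitz G f → D f ≤ 3 := fun f hf => hf.neighborAvg_sub_le_three h
  have hδ : ∀ f, IsOneLipschitz G f → f x - f y ≤ 1 := fun f hf =>
    (abs_le.1 (hf.abs_sub_le_one h)).2
  have hne : ∀ α, (S α).Nonempty := fun α =>
    ⟨val α 0, 0, isOneLipschitz_of_adj (by simp), rfl⟩
  have hbdd : ∀ α ∈ Set.Ioo (0 : ℝ) 1, BddAbove (S α) := by
    rintro α ⟨h0, h1⟩
    refine ⟨α * 1 + (1 - α) * 3, ?_⟩
    rintro _ ⟨f, hf, rfl⟩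
    have := hD3 f hf
    have := hδ f hf
    have : 0 ≤ 1 - α := by linarith
    simp only [hval]
    gcongr
  set g : ℝ → ℝ := fun α => alphaCurvature G α x y / (1 - α) with hg
  have hgle : ∀ α ∈ Set.Ioo (0 : ℝ) 1, ∀ f, IsOneLipschitz G f →
      g α ≤ (1 - val α f) / (1 - α) := by
    intro α hα f hf
    have h1 : 0 < 1 - α := by linarith [hα.2]
    simp only [hg, hcurv]
    have := le_csSup (hbdd α hα) ⟨f, hf, rfl⟩
    gcongr
  have hleg : ∀ α ∈ Set.Ioo (0 : ℝ) 1, ∀ L, (∀ f, IsOneLipschitz G f →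
      L ≤ (1 - val α f) / (1 - α)) → L ≤ g α := by
    intro α hα L hL
    have h1 : 0 < 1 - α := by linarith [hα.2]
    simp only [hg, hcurv]
    rw [le_div_iff₀ h1]
    have : sSup (S α) ≤ 1 - L * (1 - α) := by
      apply csSup_le (hne α)
      rintro _ ⟨f, hf, rfl⟩
      have := hL f hf
      rw [le_div_iff₀ h1] at this
      linarith
    linarith
  have hterm : ∀ α ∈ Set.Ioo (0 : ℝ) 1, ∀ f, (1 - val α f) / (1 - α) =
      (1 - (f x - f y)) / (1 - α) + (f x - f y) - D f := by
    intro α hα f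
    have h1 : 1 - α ≠ 0 := by linarith [hα.2]
    simp only [hval]
    field_simp
    ring
  have hmono : MonotoneOn g (Set.Ioo 0 1) := by
    intro α hα β hβ hαβ
    refine hleg β hβ _ fun f hf => (hgle α hα f hf).trans ?_
    rw [hterm α hα, hterm β hβ]
    have := hδ f hf
    have : 0 ≤ 1 - (f x - f y) := by linarith
    have : 0 < 1 - β := by linarith [hβ.2]
    gcongr
  have hup : ∀ f, IsOneLipschitz G f → f x - f y = 1 → ∀ α ∈ Set.Ioo (0 : ℝ) 1, g α ≤ 1 - D f := by
    intro f hf h1 α hα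
    refine (hgle α hα f hf).trans ?_
    rw [hterm α hα, h1]
    simp
  have hbg : BddAbove (g '' Set.Ioo 0 1) := by
    refine ⟨1 - D (fun v => if v = y then 0 else 1), ?_⟩
    rintro _ ⟨α, hα, rfl⟩
    refine hup _ (isOneLipschitz_of_adj fun u v _ => ?_) (by simp [hxy]) α hα
    split_ifs <;> norm_num
  refine ⟨sSup (g '' Set.Ioo 0 1),
    hmono.tendsto_nhdsWithin_Ioo_left ⟨1 / 2, by norm_num, by norm_num⟩ hbg, ?_, ?_⟩
  · intro f hf h1
    apply csSup_le (Set.Nonempty.image _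
      (⟨1 / 2, by norm_num, by norm_num⟩ : (Set.Ioo (0 : ℝ) 1).Nonempty))
    rintro _ ⟨α, hα, rfl⟩
    exact hup f hf h1 α hα
  · intro L hL
    -- since `f x - f y ≤ 1`, every single `α` already gives a term at least `1 - D f`
    have hα : (1 / 2 : ℝ) ∈ Set.Ioo (0 : ℝ) 1 := ⟨by norm_num, by norm_num⟩
    refine le_trans (hleg _ hα L fun f hf => (hL f hf).trans ?_)
      (le_csSup hbg ⟨1 / 2, hα, rfl⟩)
    rw [hterm _ hα]
    have := hδ f hf
    simp only [hD]
    norm_num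
    linarith

end Deterministic

/-! ### Test functions and upper bounds on the curvature -/

section Deterministic

open scoped Classical

variable {V : Type*} [Fintype V] {G : SimpleGraph V} {x y : V} {f : V → ℝ}

/-- The closed ball of radius `r` around `y` in the graph `H`. -/
noncomputable def ball (H : SimpleGraph V) (y : V) : ℕ → Finset V
  | 0 => {y}
  | r + 1 => ball H y r ∪ (ball H y r).biUnion fun u => H.neighborFinset u

/-- The closed ball of radius `r` around `y` in `G - x`. -/
noncomputable def ballAvoiding (G : SimpleGraph V) (x y : V) (r : ℕ) : Finset V :=
  ball (G.deleteIncidenceSet x) y r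

lemma mem_ballAvoiding_zero {v : V} : v ∈ ballAvoiding G x y 0 ↔ v = y := by
  simp [ballAvoiding, ball]

lemma mem_ballAvoiding_succ {r : ℕ} {v : V} : v ∈ ballAvoiding G x y (r + 1) ↔
    v ∈ ballAvoiding G x y r ∨
      ∃ u ∈ ballAvoiding G x y r, G.Adj u v ∧ u ≠ x ∧ v ≠ x := by
  simp [ballAvoiding, ball, SimpleGraph.deleteIncidenceSet_adj]

lemma notMem_ballAvoiding (h : x ≠ y) (r : ℕ) : x ∉ ballAvoiding G x y r := by
  induction r with
  | zero => simpa [mem_ballAvoiding_zero] using h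
  | succ r ih => simp [mem_ballAvoiding_succ, ih]

lemma mem_ballAvoiding_one (h : x ≠ y) {v : V} :
    v ∈ ballAvoiding G x y 1 ↔ v = y ∨ G.Adj y v ∧ v ≠ x := by
  simp [mem_ballAvoiding_succ, mem_ballAvoiding_zero, h.symm]

lemma card_ballAvoiding_le {Δ : ℝ} (hΔ : ∀ v, (G.degree v : ℝ) ≤ Δ) (r : ℕ) :
    ((ballAvoiding G x y r).card : ℝ) ≤ (1 + Δ) ^ r := by
  have hΔ0 : 0 ≤ Δ := (Nat.cast_nonneg _).trans (hΔ x)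
  induction r with
  | zero => simp [ballAvoiding, ball]
  | succ r ih =>
    have hdeg : ∀ u, ((G.deleteIncidenceSet x).degree u : ℝ) ≤ Δ := fun u => by
      refine le_trans ?_ (hΔ u)
      exact_mod_cast SimpleGraph.degree_le_of_le (G.deleteIncidenceSet_le x)
    have h1 : ((ballAvoiding G x y (r + 1)).card : ℝ) ≤
        (ballAvoiding G x y r).card +
          ∑ u ∈ ballAvoiding G x y r, ((G.deleteIncidenceSet x).degree u : ℝ) := by
      have h2 : (ballAvoiding G x y (r + 1)).card ≤ (ballAvoiding G x y r).card +
          ∑ u ∈ ballAvoiding G x y r, (G.deleteIncidenceSet x).degree u := by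
        rw [ballAvoiding, ball]
        refine (Finset.card_union_le _ _).trans (Nat.add_le_add_left ?_ _)
        refine Finset.card_biUnion_le.trans (Finset.sum_le_sum fun u _ => ?_)
        rw [SimpleGraph.card_neighborFinset_eq_degree]
        exact le_of_eq (by congr!)
      exact_mod_cast h2
    have h3 : ∑ u ∈ ballAvoiding G x y r, ((G.deleteIncidenceSet x).degree u : ℝ) ≤
        (ballAvoiding G x y r).card * Δ := by
      rw [← nsmul_eq_mul]
      exact Finset.sum_le_card_nsmul _ _ _ fun u _ => hdeg u
    calc ((ballAvoiding G x y (r + 1)).card : ℝ)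
        ≤ (ballAvoiding G x y r).card * (1 + Δ) := by linarith
      _ ≤ (1 + Δ) ^ r * (1 + Δ) := by gcongr
      _ = _ := by ring

/-- The number of neighbours of `x` at distance at most `r` from `y` in `G - x`. -/
noncomputable def nearCount (G : SimpleGraph V) (x y : V) (r : ℕ) : ℕ :=
  (G.neighborFinset x ∩ ballAvoiding G x y r).card

lemma card_ballAvoiding_one (h : G.Adj x y) : (ballAvoiding G x y 1).card = G.degree y := by
  have : ballAvoiding G x y 1 = insert y ((G.neighborFinset y).erase x) := by
    ext v
    simp only [mem_ballAvoiding_one h.ne, Finset.mem_insert, Finset.mem_erase,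
      SimpleGraph.mem_neighborFinset]
    tauto
  rw [this, Finset.card_insert_of_notMem (by simp),
    Finset.card_erase_of_mem (by simpa using h.symm),
    SimpleGraph.card_neighborFinset_eq_degree]
  have := (G.degree_pos_iff_exists_adj y).2 ⟨x, h.symm⟩
  omega

lemma nearCount_one (h : G.Adj x y) :
    nearCount G x y 1 = (G.neighborFinset x ∩ G.neighborFinset y).card + 1 := by
  have : G.neighborFinset x ∩ ballAvoiding G x y 1 =
      insert y (G.neighborFinset x ∩ G.neighborFinset y) := by
    ext v
    simp only [mem_ballAvoiding_one h.ne, Finset.mem_insert, Finset.mem_inter,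
      SimpleGraph.mem_neighborFinset]
    constructor
    · tauto
    · rintro (rfl | ⟨h1, h2⟩)
      · exact ⟨h, Or.inl rfl⟩
      · exact ⟨h1, Or.inr ⟨h2, h1.ne'⟩⟩
  rw [nearCount, this, Finset.card_insert_of_notMem (by simp)]

lemma nearCount_mono {r s : ℕ} (hrs : r ≤ s) : nearCount G x y r ≤ nearCount G x y s := by
  refine Finset.card_le_card (Finset.inter_subset_inter_left ?_)
  refine monotone_nat_of_le_succ (f := ballAvoiding G x y) (fun r v hv => ?_) hrs
  exact mem_ballAvoiding_succ.2 (Or.inl hv)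

lemma degree_sub_nearCount (r : ℕ) :
    ((G.neighborFinset x \ ballAvoiding G x y r).card : ℝ) = G.degree x - nearCount G x y r := by
  have := Finset.card_sdiff_add_card_inter (G.neighborFinset x) (ballAvoiding G x y r)
  rw [SimpleGraph.card_neighborFinset_eq_degree] at this
  rw [nearCount, ← this]
  push_cast
  ring

/-- A function which is nonnegative on the neighbours of `x`, and at least `c ≥ 0` on those which
are not within distance `r` of `y` in `G - x`, has a large average around `x`. -/
lemma le_neighborAvg_of_ballAvoiding (h : G.Adj x y) {c : ℝ} (r : ℕ)
    (h0 : ∀ u, G.Adj x u → 0 ≤ f u) (hc : ∀ u, G.Adj x u → u ∉ ballAvoiding G x y r → c ≤ f u) :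
    c - c * nearCount G x y r / G.degree x ≤ neighborAvg G f x := by
  have hd := degree_pos_real h
  have h1 : (G.neighborFinset x \ ballAvoiding G x y r).card • c ≤
      ∑ u ∈ G.neighborFinset x \ ballAvoiding G x y r, f u := by
    refine Finset.card_nsmul_le_sum _ _ _ fun u hu => ?_
    simp only [Finset.mem_sdiff, SimpleGraph.mem_neighborFinset] at hu
    exact hc u hu.1 hu.2
  have h2 : ∑ u ∈ G.neighborFinset x \ ballAvoiding G x y r, f u ≤
      ∑ u ∈ G.neighborFinset x, f u := by
    refine Finset.sum_le_sum_of_subset_of_nonneg Finset.sdiff_subset fun u hu _ => ?_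
    exact h0 u (by simpa using hu)
  rw [nsmul_eq_mul, degree_sub_nearCount] at h1
  rw [neighborAvg, le_div_iff₀ hd]
  have : (c - c * nearCount G x y r / G.degree x) * G.degree x =
      (G.degree x - nearCount G x y r) * c := by field_simp
  linarith

/-- The test function with value `1` at `x` and at the neighbours of `x` outside the closed
neighbourhood of `y`, and `0` elsewhere, bounds the curvature by the density of triangles. -/
lemma exists_test_triangles (h : G.Adj x y) : ∃ f, IsOneLipschitz G f ∧ f x - f y = 1 ∧
    1 - (neighborAvg G f x - neighborAvg G f y) ≤
      nearCount G x y 1 / G.degree x + 1 / G.degree y := by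
  set B := ballAvoiding G x y 1 with hB
  have hmem : ∀ v, v ∈ B ↔ v = y ∨ G.Adj y v ∧ v ≠ x := fun v => mem_ballAvoiding_one h.ne
  set f : V → ℝ := fun v => if v = x ∨ (G.Adj x v ∧ v ∉ B) then 1 else 0 with hf
  have hyB : y ∈ B := (hmem y).2 (Or.inl rfl)
  have hf0 : ∀ v, 0 ≤ f v := fun v => by simp only [hf]; split_ifs <;> norm_num
  have hf1 : ∀ v, f v ≤ 1 := fun v => by simp only [hf]; split_ifs <;> norm_num
  have hfy : f y = 0 := by simp [hf, h.ne', hyB]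
  refine ⟨f, isOneLipschitz_of_adj fun u v _ => by linarith [hf0 v, hf1 u], ?_, ?_⟩
  · rw [hfy]; simp [hf]
  · have h1 := le_neighborAvg_of_ballAvoiding (f := f) (c := 1) h 1 (fun u _ => hf0 u)
      (fun u hu hu' => by simp [hf, hu, hB, hu'])
    have h2 : neighborAvg G f y = 1 / G.degree y := by
      rw [neighborAvg, Finset.sum_eq_single x]
      · simp [hf]
      · intro v hv hvx
        have hv' : G.Adj y v := by simpa using hv
        have : v ∈ B := (hmem v).2 (Or.inr ⟨hv', hvx⟩)
        simp [hf, hvx, this]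
      · intro hx
        exact absurd h.symm (by simpa using hx)
    rw [h2]
    rw [one_mul] at h1
    linarith

/-- The test function with value `2` at the neighbours of `x` which are not within distance `2`
of `y` in `G - x`, value `0` at `y` and at the other neighbours of `y`, and `1` elsewhere. -/
lemma exists_test_squares (h : G.Adj x y) : ∃ f, IsOneLipschitz G f ∧ f x - f y = 1 ∧
    1 - (neighborAvg G f x - neighborAvg G f y) ≤
      -1 + 2 * nearCount G x y 2 / G.degree x + 1 / G.degree y := by
  set B := ballAvoiding G x y with hB
  have hmem : ∀ v, v ∈ B 1 ↔ v = y ∨ G.Adj y v ∧ v ≠ x := fun v => mem_ballAvoiding_one h.ne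
  have hxB : x ∉ B 1 := notMem_ballAvoiding h.ne 1
  have hB12 : ∀ v, v ∈ B 1 → v ∈ B 2 := fun v hv => mem_ballAvoiding_succ.2 (Or.inl hv)
  set f : V → ℝ := fun v => if v ∈ B 1 then 0 else if G.Adj x v ∧ v ∉ B 2 then 2 else 1 with hf
  have hyB : y ∈ B 1 := (hmem y).2 (Or.inl rfl)
  have hfx : f x = 1 := by simp [hf, hxB]
  have hfy : f y = 0 := by simp [hf, hyB]
  have hf0 : ∀ v, 0 ≤ f v := fun v => by simp only [hf]; split_ifs <;> norm_num
  refine ⟨f, isOneLipschitz_of_adj fun u v huv => ?_, ?_, ?_⟩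
  · by_cases hv : v ∈ B 1
    · have : ¬ (G.Adj x u ∧ u ∉ B 2) := by
        rintro ⟨h1, h2⟩
        exact h2 (mem_ballAvoiding_succ.2
          (Or.inr ⟨v, hv, huv.symm, fun e => hxB (e ▸ hv), h1.ne'⟩))
      simp only [hf, this, if_false]
      split_ifs <;> norm_num
    · simp only [hf, hv, if_false]
      split_ifs <;> norm_num
  · rw [hfx, hfy]; norm_num
  · have h1 := le_neighborAvg_of_ballAvoiding (f := f) (c := 2) h 2 (fun u _ => hf0 u)
      (fun u hu hu' => by
        have h3 : u ∉ B 1 := fun h => hu' (hB12 u h)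
        have h4 : u ∉ B 2 := hu'
        simp [hf, hu, h3, h4])
    have h2 : neighborAvg G f y = 1 / G.degree y := by
      rw [neighborAvg, Finset.sum_eq_single x, hfx]
      · intro v hv hvx
        have hv' : G.Adj y v := by simpa using hv
        have : v ∈ B 1 := (hmem v).2 (Or.inr ⟨hv', hvx⟩)
        simp [hf, this]
      · intro hx
        exact absurd h.symm (by simpa using hx)
    rw [h2]
    linarith

/-- The test function with value `2` on the set `U` of neighbours of `x` which are not within
distance `3` of `y` in `G - x`, value `1` at `x` and the neighbours of `U`, value `-1` at the
neighbours of `y` outside the closed neighbourhood of `x`, and `0` elsewhere. -/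
lemma exists_test_pentagons (h : G.Adj x y) : ∃ f, IsOneLipschitz G f ∧ f x - f y = 1 ∧
    1 - (neighborAvg G f x - neighborAvg G f y) ≤
      -2 + 2 * nearCount G x y 3 / G.degree x + 3 * nearCount G x y 1 / G.degree y := by
  set B := ballAvoiding G x y with hB
  have hmem : ∀ v, v ∈ B 1 ↔ v = y ∨ G.Adj y v ∧ v ≠ x := fun v => mem_ballAvoiding_one h.ne
  have hstep : ∀ r u v, u ∈ B r → G.Adj u v → u ≠ x → v ≠ x → v ∈ B (r + 1) :=
    fun r u v h1 h2 h3 h4 => mem_ballAvoiding_succ.2 (Or.inr ⟨u, h1, h2, h3, h4⟩)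
  have hsub : ∀ r v, v ∈ B r → v ∈ B (r + 1) := fun r v hv => mem_ballAvoiding_succ.2 (Or.inl hv)
  have hxB : ∀ r, x ∉ B r := notMem_ballAvoiding h.ne
  have hyB : y ∈ B 0 := mem_ballAvoiding_zero.2 rfl
  set U : V → Prop := fun v => G.Adj x v ∧ v ∉ B 3 with hU
  set N : V → Prop := fun v => v = x ∨ ∃ u, U u ∧ G.Adj u v with hN
  set W : V → Prop := fun v => G.Adj y v ∧ v ≠ x ∧ ¬ G.Adj x v with hW
  have hWB : ∀ v, W v → v ∈ B 1 := fun v hv => (hmem v).2 (Or.inr ⟨hv.1, hv.2.1⟩)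
  have hNB : ∀ v, v ∈ B 2 → ¬ N v := by
    rintro v hv (rfl | ⟨u, ⟨hu, hu3⟩, huv⟩)
    · exact hxB 2 hv
    · exact hu3 (hstep 2 v u hv huv.symm (fun e => hxB 2 (e ▸ hv)) hu.ne')
  have hUB : ∀ v, v ∈ B 3 → ¬ U v := fun v hv hu => hu.2 hv
  set f : V → ℝ := fun v => if U v then 2 else if N v then 1 else if W v then -1 else 0 with hf
  have hUx : ¬ U x := fun hu => hu.1.ne rfl
  have hfx : f x = 1 := by simp [hf, hUx, hN]
  have hWy : ¬ W y := fun hw => hw.1.ne rfl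
  have hfy : f y = 0 := by
    have h2 : y ∈ B 2 := hsub 1 y (hsub 0 y hyB)
    simp [hf, hUB y (hsub 2 y h2), hNB y h2, hWy]
  have hfW : ∀ v, W v → f v = -1 := fun v hv => by
    have h2 : v ∈ B 2 := hsub 1 v (hWB v hv)
    simp [hf, hUB v (hsub 2 v h2), hNB v h2, hv]
  have hf2 : ∀ v, f v ≤ 2 := fun v => by simp only [hf]; split_ifs <;> norm_num
  have hf1 : ∀ v, -1 ≤ f v := fun v => by simp only [hf]; split_ifs <;> norm_num
  have hf0 : ∀ v, ¬ W v → 0 ≤ f v := fun v hv => by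
    simp only [hf, hv, if_false]; split_ifs <;> norm_num
  refine ⟨f, isOneLipschitz_of_adj fun u v huv => ?_, ?_, ?_⟩
  · by_cases hu : U u
    · have hv : N v := Or.inr ⟨u, hu, huv⟩
      have : 1 ≤ f v := by simp only [hf, hv, if_true]; split_ifs <;> norm_num
      linarith [hf2 u]
    · by_cases hv : W v
      · have hun : ¬ N u := by
          by_cases hux : u = x
          · subst hux; exact absurd huv hv.2.2
          · exact hNB u (hstep 1 v u (hWB v hv) huv.symm hv.2.1 hux)
        have : f u ≤ 0 := by simp only [hf, hu, hun, if_false]; split_ifs <;> norm_num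
        linarith [hf1 v]
      · have : f u ≤ 1 := by simp only [hf, hu, if_false]; split_ifs <;> norm_num
        linarith [hf0 v hv]
  · rw [hfx, hfy]; norm_num
  · have h1 := le_neighborAvg_of_ballAvoiding (f := f) (c := 2) h 3
      (fun u hu => hf0 u fun hw => hw.2.2 hu)
      (fun u hu hu' => by
        have : U u := ⟨hu, hu'⟩
        simp [hf, this])
    have hd := degree_pos_real h.symm
    have h2 : neighborAvg G f y ≤ -1 + 3 * nearCount G x y 1 / G.degree y := by
      rw [neighborAvg, div_le_iff₀ hd]
      have e1 : ∀ u ∈ G.neighborFinset y, f u ≤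
          -1 + 3 * ((if u = x then 1 else 0) + if G.Adj x u then 1 else 0) := by
        intro u hu
        have hu' : G.Adj y u := by simpa using hu
        by_cases hux : u = x
        · subst hux; simp [hfx]; norm_num
        · by_cases hxu : G.Adj x u
          · simp only [hux, hxu, if_true, if_false]; linarith [hf2 u]
          · rw [hfW u ⟨hu', hux, hxu⟩]; simp [hux, hxu]
      have e2 := Finset.sum_le_sum e1
      rw [Finset.sum_add_distrib, ← Finset.mul_sum, Finset.sum_add_distrib,
        Finset.sum_const, SimpleGraph.card_neighborFinset_eq_degree, Finset.sum_ite_eq',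
        ← Finset.sum_filter, Finset.sum_const] at e2
      have e3 : (G.neighborFinset y).filter (fun u => G.Adj x u) =
          G.neighborFinset x ∩ G.neighborFinset y := by
        ext; simp [and_comm]
      have hx : x ∈ G.neighborFinset y := by simpa using h.symm
      have e4 := nearCount_one h
      rw [e3, if_pos hx] at e2
      have e5 : (-1 + 3 * (nearCount G x y 1 : ℝ) / G.degree y) * G.degree y =
        -G.degree y + 3 * nearCount G x y 1 := by field_simp
      rw [e5, e4]
      simp only [nsmul_eq_mul] at e2
      push_cast
      linarith
    linarith

end Deterministic

/-! ### Thresholds and lower bounds on the curvature -/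

section Deterministic

open scoped Classical

/-- Every finite set contains `s` points where `g` takes its `s` largest values. -/
lemma exists_top_subset {ι : Type*} (g : ι → ℝ) (X : Finset ι) (s : ℕ) (hs : s ≤ X.card) :
    ∃ A ⊆ X, A.card = s ∧ ∀ u ∈ A, ∀ v ∈ X \ A, g v ≤ g u := by
  induction s with
  | zero => exact ⟨∅, by simp, rfl, by simp⟩
  | succ s ih =>
    obtain ⟨A, hA, hcard, htop⟩ := ih (by omega)
    have hne : (X \ A).Nonempty := by
      rw [← Finset.card_pos, Finset.card_sdiff_of_subset hA]; omega
    obtain ⟨m, hm, hmax⟩ := Finset.exists_max_image (X \ A) g hne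
    have hm' := Finset.mem_sdiff.1 hm
    refine ⟨insert m A, Finset.insert_subset hm'.1 hA, ?_, ?_⟩
    · rw [Finset.card_insert_of_notMem hm'.2, hcard]
    · intro u hu v hv
      have hv' : v ∈ X \ A := by
        simp only [Finset.mem_sdiff, Finset.mem_insert, not_or] at hv ⊢
        exact ⟨hv.1, hv.2.2⟩
      rcases Finset.mem_insert.1 hu with rfl | hu
      · exact hmax v hv'
      · exact htop u hu v hv'

/-- If among any `s` points of `X` and `s` points of `Y` there are `a ∈ X`, `b ∈ Y` with
`g a ≤ g b + r`, then a single threshold `F` separates the values: up to `s` exceptions on each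
side, `g ≤ F` on `X` and `g ≥ F - r` on `Y`. -/
lemma exists_threshold {ι : Type*} (g : ι → ℝ) (X Y : Finset ι) (s : ℕ) {r M : ℝ}
    (hr0 : 0 ≤ r) (hrM : r ≤ 2 * M) (hX : ∀ u ∈ X, |g u| ≤ M) (hY : ∀ u ∈ Y, |g u| ≤ M)
    (hhole : ∀ A ⊆ X, ∀ B ⊆ Y, A.card = s → B.card = s → ∃ a ∈ A, ∃ b ∈ B, g a ≤ g b + r) :
    ∃ F : ℝ, |F| ≤ M ∧ ∃ A ⊆ X, ∃ B ⊆ Y, A.card ≤ s ∧ B.card ≤ s ∧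
      (∀ u ∈ X \ A, g u ≤ F) ∧ ∀ u ∈ Y \ B, F - r ≤ g u := by
  -- if one side has fewer than `s` points, they are all exceptional
  by_cases hXs : X.card < s
  · refine ⟨r - M, abs_le.2 ⟨by linarith, by linarith⟩, X, subset_rfl, ∅, by simp, hXs.le,
      by simp, by simp, fun u hu => ?_⟩
    have := abs_le.1 (hY u (by simpa using hu))
    linarith
  by_cases hYs : Y.card < s
  · refine ⟨M, abs_le.2 ⟨by linarith, le_rfl⟩, ∅, by simp, Y, subset_rfl, by simp, hYs.le,
      fun u hu => ?_, by simp⟩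
    exact (abs_le.1 (hX u (by simpa using hu))).2
  obtain ⟨A, hA, hAs, htop⟩ := exists_top_subset g X s (by omega)
  obtain ⟨B, hB, hBs, hbot⟩ := exists_top_subset (fun u => -g u) Y s (by omega)
  obtain ⟨a, ha, b, hb, hab⟩ := hhole A hA B hB hAs hBs
  refine ⟨g a, hX a (hA ha), A, hA, B, hB, hAs.le, hBs.le, htop a ha, fun u hu => ?_⟩
  have := hbot b hb u hu
  linarith

lemma sum_le_of_threshold {ι : Type*} (g : ι → ℝ) {X A : Finset ι} {s : ℕ} {F : ℝ} (hA : A ⊆ X)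
    (hAs : A.card ≤ s) (hX : ∀ u ∈ X, g u - F ≤ 4) (htop : ∀ u ∈ X \ A, g u ≤ F) :
    ∑ u ∈ X, (g u - F) ≤ 4 * s := by
  rw [← Finset.sum_sdiff hA]
  have h1 : ∑ u ∈ X \ A, (g u - F) ≤ 0 :=
    Finset.sum_nonpos fun u hu => by linarith [htop u hu]
  have h2 := Finset.sum_le_card_nsmul A (fun u => g u - F) 4 fun u hu => hX u (hA hu)
  rw [nsmul_eq_mul] at h2
  have h3 : (A.card : ℝ) ≤ s := by exact_mod_cast hAs
  linarith

variable {V : Type*} [Fintype V] {G : SimpleGraph V} {x y : V} {f : V → ℝ}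

/-- The transport bound, in dual form. If every `s` neighbours of `x` and `s` neighbours of `y`
outside a set `C` of common neighbours contain a pair on which `f` drops by at most `r`, then the
averages of `f` around `x` and `y` differ by at most `r` times the proportion of mass that is not
common, up to the error caused by `s` exceptional points and by different degrees. -/
lemma neighborAvg_sub_le_of_hole (hf : IsOneLipschitz G f) (h : G.Adj x y) {C : Finset V}
    (hCx : C ⊆ G.neighborFinset x) (hCy : C ⊆ G.neighborFinset y) {r : ℝ} (s : ℕ)
    (hr0 : 0 ≤ r) (hr4 : r ≤ 4)
    (hhole : ∀ A ⊆ G.neighborFinset x \ C, ∀ B ⊆ G.neighborFinset y \ C,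
      A.card = s → B.card = s → ∃ a ∈ A, ∃ b ∈ B, f a ≤ f b + r) :
    neighborAvg G f x - neighborAvg G f y ≤ r * (1 - C.card / G.degree y) +
      4 * |(G.degree x : ℝ) - G.degree y| / G.degree y +
      4 * s * (1 / G.degree x + 1 / G.degree y) := by
  have hdx := degree_pos_real h
  have hdy := degree_pos_real h.symm
  set g : V → ℝ := fun v => f v - f y with hg
  have hgx : ∀ u ∈ G.neighborFinset x, |g u| ≤ 2 := by
    intro u hu
    have h1 := abs_le.1 (hf.abs_sub_le_one ((G.mem_neighborFinset x u).1 hu))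
    have h2 := abs_le.1 (hf.abs_sub_le_one h)
    simp only [hg]
    rw [abs_le]
    constructor <;> linarith
  have hgy : ∀ u ∈ G.neighborFinset y, |g u| ≤ 2 := by
    intro u hu
    have h1 := abs_le.1 (hf.abs_sub_le_one ((G.mem_neighborFinset y u).1 hu))
    simp only [hg]
    rw [abs_le]
    constructor <;> linarith
  obtain ⟨F, hF, A, hA, B, hB, hAs, hBs, htop, hbot⟩ :=
    exists_threshold g (G.neighborFinset x \ C) (G.neighborFinset y \ C) s (M := 2) hr0
      (by linarith) (fun u hu => hgx u (Finset.sdiff_subset hu))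
      (fun u hu => hgy u (Finset.sdiff_subset hu))
      (fun A hA B hB hAs hBs => by
        obtain ⟨a, ha, b, hb, hab⟩ := hhole A hA B hB hAs hBs
        exact ⟨a, ha, b, hb, by simp only [hg]; linarith⟩)
  have hF' := abs_le.1 hF
  have hX := sum_le_of_threshold g hA hAs
    (fun u hu => by linarith [(abs_le.1 (hgx u (Finset.sdiff_subset hu))).2]) htop
  have hY := sum_le_of_threshold (fun u => -g u) (F := r - F) hB hBs
    (fun u hu => by linarith [(abs_le.1 (hgy u (Finset.sdiff_subset hu))).1])
    (fun u hu => by linarith [hbot u hu])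
  have hcardx : ((G.neighborFinset x \ C).card : ℝ) = G.degree x - C.card := by
    rw [Finset.card_sdiff_of_subset hCx, SimpleGraph.card_neighborFinset_eq_degree,
      Nat.cast_sub (by
        rw [← SimpleGraph.card_neighborFinset_eq_degree]; exact Finset.card_le_card hCx)]
  have hcardy : ((G.neighborFinset y \ C).card : ℝ) = G.degree y - C.card := by
    rw [Finset.card_sdiff_of_subset hCy, SimpleGraph.card_neighborFinset_eq_degree,
      Nat.cast_sub (by
        rw [← SimpleGraph.card_neighborFinset_eq_degree]; exact Finset.card_le_card hCy)]
  -- the total of `g - F` over each neighbourhood, split along `C`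
  set T : ℝ := ∑ u ∈ C, (g u - F) with hT
  have hTabs : |T| ≤ 4 * C.card := by
    refine (Finset.abs_sum_le_sum_abs _ _).trans ?_
    have := Finset.sum_le_card_nsmul C (fun u => |g u - F|) 4 fun u hu => by
      have := abs_le.1 (hgx u (hCx hu))
      exact abs_le.2 ⟨by linarith, by linarith⟩
    rw [nsmul_eq_mul] at this
    linarith
  have hsx : ∑ u ∈ G.neighborFinset x, (g u - F) ≤ T + 4 * s := by
    rw [← Finset.sum_sdiff hCx]; linarith
  have hsy : T - r * (G.degree y - C.card) - 4 * s ≤ ∑ u ∈ G.neighborFinset y, (g u - F) := by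
    rw [← Finset.sum_sdiff hCy]
    have : ∑ u ∈ G.neighborFinset y \ C, (-g u - (r - F)) =
        -∑ u ∈ G.neighborFinset y \ C, (g u - F) - r * (G.degree y - C.card) := by
      rw [← hcardy, mul_comm, ← nsmul_eq_mul, ← Finset.sum_const, ← Finset.sum_neg_distrib,
        ← Finset.sum_sub_distrib]
      exact Finset.sum_congr rfl fun u _ => by ring
    linarith
  have havx : neighborAvg G f x = (f y + F) +
      (∑ u ∈ G.neighborFinset x, (g u - F)) / G.degree x := by
    have := neighborAvg_sub_const (f := f) h (f y + F)
    have e : neighborAvg G (fun v => f v - (f y + F)) x =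
      (∑ u ∈ G.neighborFinset x, (g u - F)) / G.degree x := by
      rw [neighborAvg]
      congr 1
      exact Finset.sum_congr rfl fun u _ => by simp only [hg]; ring
    linarith
  have havy : neighborAvg G f y = (f y + F) +
      (∑ u ∈ G.neighborFinset y, (g u - F)) / G.degree y := by
    have := neighborAvg_sub_const (f := f) h.symm (f y + F)
    have e : neighborAvg G (fun v => f v - (f y + F)) y =
      (∑ u ∈ G.neighborFinset y, (g u - F)) / G.degree y := by
      rw [neighborAvg]
      congr 1
      exact Finset.sum_congr rfl fun u _ => by simp only [hg]; ring
    linarith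
  have hx' : (∑ u ∈ G.neighborFinset x, (g u - F)) / G.degree x ≤ (T + 4 * s) / G.degree x := by
    gcongr
  have hy' : (T - r * (G.degree y - C.card) - 4 * s) / G.degree y ≤
      (∑ u ∈ G.neighborFinset y, (g u - F)) / G.degree y := by
    gcongr
  have hC : (C.card : ℝ) ≤ G.degree x := by
    rw [← SimpleGraph.card_neighborFinset_eq_degree]
    exact_mod_cast Finset.card_le_card hCx
  have hTd : T / G.degree x - T / G.degree y ≤
      4 * |(G.degree x : ℝ) - G.degree y| / G.degree y := by
    have e : T / G.degree x - T / G.degree y =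
        (T / G.degree x) * (G.degree y - G.degree x) / G.degree y := by field_simp
    rw [e]
    refine div_le_div_of_nonneg_right ?_ hdy.le
    have h4 : |T / G.degree x| ≤ 4 := by
      rw [abs_div, abs_of_pos hdx, div_le_iff₀ hdx]
      linarith
    calc _ ≤ |(T / G.degree x) * (G.degree y - G.degree x)| := le_abs_self _
      _ = |T / G.degree x| * |(G.degree x : ℝ) - G.degree y| := by rw [abs_mul, abs_sub_comm]
      _ ≤ _ := by gcongr
  have e1 : (T + 4 * s) / G.degree x - (T - r * (G.degree y - C.card) - 4 * s) / G.degree y =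
      (T / G.degree x - T / G.degree y) + r * (1 - C.card / G.degree y) +
      4 * s * (1 / G.degree x + 1 / G.degree y) := by
    field_simp
    ring
  linarith

end Deterministic

/-! ### Independence in the binomial random graph -/

section Probability

open scoped Classical

variable {V : Type*}

/-- The event `E` is determined by which of the pairs in `T` are edges. -/
def DependsOn (E : Set (SimpleGraph V)) (T : Finset (Sym2 V)) : Prop :=
  ∀ G H : SimpleGraph V, (∀ e ∈ T, e ∈ G.edgeSet ↔ e ∈ H.edgeSet) → (G ∈ E ↔ H ∈ E)

lemma DependsOn.mono {E : Set (SimpleGraph V)} {S T : Finset (Sym2 V)} (h : DependsOn E S)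
    (hST : S ⊆ T) : DependsOn E T := fun G H hGH => h G H fun e he => hGH e (hST he)

lemma DependsOn.inter {E F : Set (SimpleGraph V)} {S T : Finset (Sym2 V)} (hE : DependsOn E S)
    (hF : DependsOn F T) : DependsOn (E ∩ F) (S ∪ T) := fun G H hGH =>
  and_congr (hE.mono Finset.subset_union_left G H hGH) (hF.mono Finset.subset_union_right G H hGH)

lemma DependsOn.exists_preimage {E : Set (SimpleGraph V)} {T : Finset (Sym2 V)}
    (h : DependsOn E T) : ∃ E' : Set (T → Prop), E = (fun G (e : T) => e.1 ∈ G.edgeSet) ⁻¹' E' := by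
  refine ⟨(fun G (e : T) => e.1 ∈ G.edgeSet) '' E, ?_⟩
  ext G
  refine ⟨fun hG => ⟨G, hG, rfl⟩, ?_⟩
  rintro ⟨H, hH, hHG⟩
  refine (h H G fun e he => ?_).1 hH
  exact (congrFun hHG ⟨e, he⟩).to_iff

lemma DependsOn.biInter {ι : Type*} {I : Finset ι} {E : ι → Set (SimpleGraph V)}
    {T : ι → Finset (Sym2 V)} (hE : ∀ i ∈ I, DependsOn (E i) (T i)) :
    DependsOn (⋂ i ∈ I, E i) (I.biUnion T) := by
  intro G H hGH
  simp only [Set.mem_iInter]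
  refine forall₂_congr fun i hi => hE i hi G H fun e he => hGH e ?_
  exact Finset.mem_biUnion.2 ⟨i, hi, he⟩

lemma dependsOn_notMem (e : Sym2 V) : DependsOn {G : SimpleGraph V | e ∉ G.edgeSet} {e} :=
  fun _ _ h => not_congr (h e (by simp))

variable [Fintype V] {p : unitInterval}

lemma measurableSet_simpleGraph (E : Set (SimpleGraph V)) : MeasurableSet E := by
  have hs : ∀ G : SimpleGraph V, MeasurableSet ({G} : Set (SimpleGraph V)) := by
    intro G
    have : ({G} : Set (SimpleGraph V)) = SimpleGraph.edgeSet ⁻¹' {G.edgeSet} := by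
      ext H; simp
    rw [this]
    exact SimpleGraph.measurable_edgeSet (measurableSet_singleton _)
  rw [← Set.biUnion_of_singleton E]
  exact E.toFinite.measurableSet_biUnion fun G _ => hs G

lemma measurable_simpleGraph {β : Type*} [MeasurableSpace β] (f : SimpleGraph V → β) :
    Measurable f := fun _ _ => measurableSet_simpleGraph _

/-- The law of the family of edge indicators is the product measure underlying the definition of
the binomial random graph. -/
lemma map_mem_edgeSet_binomialRandom :
    (SimpleGraph.binomialRandom V p).map (fun G (e : Sym2 V) => e ∈ G.edgeSet) =
      Measure.infinitePi fun e : Sym2 V => unitInterval.toNNReal p • Measure.dirac (¬ e.IsDiag) +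
        unitInterval.toNNReal (unitInterval.symm p) • Measure.dirac False := by
  have h1 : (SimpleGraph.binomialRandom V p).map SimpleGraph.edgeSet =
      setBernoulli (Sym2.diagSet (α := V))ᶜ p := by
    rw [SimpleGraph.binomialRandom, SimpleGraph.measurableEmbedding_edgeSet.map_comap]
    refine Measure.restrict_eq_self_of_ae_mem ?_
    filter_upwards [setBernoulli_ae_subset] with S hS
    exact ⟨SimpleGraph.fromEdgeSet S, by
      simpa [← Set.compl_ofPred, Set.subset_compl_iff_disjoint_right] using hS⟩
  have h2 : Measurable fun (S : Set (Sym2 V)) (e : Sym2 V) => e ∈ S :=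
    MeasurableEquiv.setOfPred.symm.measurable
  have h3 : Measurable fun (q : Sym2 V → Prop) => {e | q e} :=
    MeasurableEquiv.setOfPred.measurable
  have h4 : (fun (G : SimpleGraph V) (e : Sym2 V) => e ∈ G.edgeSet) =
      (fun (S : Set (Sym2 V)) (e : Sym2 V) => e ∈ S) ∘ SimpleGraph.edgeSet := rfl
  rw [h4, ← Measure.map_map h2 SimpleGraph.measurable_edgeSet, h1, setBernoulli_eq_map,
    Measure.map_map h2 h3]
  exact Measure.map_id

lemma hasLaw_mem_edgeSet (e : Sym2 V) : HasLaw (fun G : SimpleGraph V => e ∈ G.edgeSet)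
    (unitInterval.toNNReal p • Measure.dirac (¬ e.IsDiag) +
      unitInterval.toNNReal (unitInterval.symm p) • Measure.dirac False)
    (SimpleGraph.binomialRandom V p) := by
  refine ⟨(measurable_simpleGraph _).aemeasurable, ?_⟩
  have h : (fun G : SimpleGraph V => e ∈ G.edgeSet) =
      (fun q : Sym2 V → Prop => q e) ∘ fun G e => e ∈ G.edgeSet := rfl
  rw [h, ← Measure.map_map (measurable_pi_apply e) (measurable_simpleGraph _),
    map_mem_edgeSet_binomialRandom]
  exact Measure.infinitePi_map_eval _ e

/-- The indicators of the edges of the binomial random graph are independent. -/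
lemma iIndepFun_mem_edgeSet : iIndepFun (fun (e : Sym2 V) (G : SimpleGraph V) => e ∈ G.edgeSet)
    (SimpleGraph.binomialRandom V p) := by
  rw [iIndepFun_iff_hasLaw_Pi_infinitePi hasLaw_mem_edgeSet
    ((measurable_simpleGraph _).aemeasurable)]
  exact ⟨(measurable_simpleGraph _).aemeasurable,
    map_mem_edgeSet_binomialRandom⟩

lemma binomialRandom_real_mem_edgeSet {e : Sym2 V} (he : ¬ e.IsDiag) :
    (SimpleGraph.binomialRandom V p).real {G | e ∈ G.edgeSet} = p := by
  have h := (hasLaw_mem_edgeSet (p := p) e).map_eq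
  have h2 : (SimpleGraph.binomialRandom V p) {G | e ∈ G.edgeSet} =
      ((SimpleGraph.binomialRandom V p).map fun G : SimpleGraph V => e ∈ G.edgeSet) {True} := by
    rw [Measure.map_apply (measurable_simpleGraph _) .of_discrete]
    congr 1
    ext G
    simp
  rw [measureReal_def, h2, h]
  simp [he]

/-- Events determined by disjoint sets of pairs are independent. -/
lemma DependsOn.real_inter {E F : Set (SimpleGraph V)} {S T : Finset (Sym2 V)}
    (hE : DependsOn E S) (hF : DependsOn F T) (hST : Disjoint S T) :
    (SimpleGraph.binomialRandom V p).real (E ∩ F) =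
      (SimpleGraph.binomialRandom V p).real E * (SimpleGraph.binomialRandom V p).real F := by
  obtain ⟨E', rfl⟩ := hE.exists_preimage
  obtain ⟨F', rfl⟩ := hF.exists_preimage
  have hind := (iIndepFun_mem_edgeSet (V := V) (p := p)).indepFun_finset S T hST
    (fun e => measurable_simpleGraph _)
  simp only [measureReal_def]
  rw [← ENNReal.toReal_mul]
  exact congrArg _ (hind.measure_inter_preimage_eq_mul E' F' .of_discrete .of_discrete)

/-- The probability of a conjunction of events determined by pairwise disjoint sets of pairs. -/
lemma DependsOn.real_biInter {ι : Type*} {I : Finset ι} {E : ι → Set (SimpleGraph V)}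
    {T : ι → Finset (Sym2 V)} (hE : ∀ i ∈ I, DependsOn (E i) (T i))
    (hT : (I : Set ι).PairwiseDisjoint T) :
    (SimpleGraph.binomialRandom V p).real (⋂ i ∈ I, E i) =
      ∏ i ∈ I, (SimpleGraph.binomialRandom V p).real (E i) := by
  induction I using Finset.induction_on with
  | empty => simp
  | insert a I ha ih =>
    rw [Finset.prod_insert ha, Finset.set_biInter_insert,
      (hE a (Finset.mem_insert_self a I)).real_inter
        (DependsOn.biInter fun i hi => hE i (Finset.mem_insert_of_mem hi)), ih]
    · exact fun i hi => hE i (Finset.mem_insert_of_mem hi)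
    · exact hT.subset (by simp)
    · rw [Finset.disjoint_biUnion_right]
      intro i hi
      exact hT (by simp) (by simp [hi]) (fun e => ha (e ▸ hi))

lemma binomialRandom_real_notMem_edgeSet {e : Sym2 V} (he : ¬ e.IsDiag) :
    (SimpleGraph.binomialRandom V p).real {G | e ∉ G.edgeSet} = 1 - p := by
  rw [← binomialRandom_real_mem_edgeSet (p := p) he]
  exact probReal_compl_eq_one_sub (measurableSet_simpleGraph _)

lemma binomialRandom_real_forall_notMem {T : Finset (Sym2 V)} (hT : ∀ e ∈ T, ¬ e.IsDiag) :
    (SimpleGraph.binomialRandom V p).real {G | ∀ e ∈ T, e ∉ G.edgeSet} =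
      (1 - p : ℝ) ^ T.card := by
  have h := DependsOn.real_biInter (p := p) (I := T) (fun e _ => dependsOn_notMem e)
    (fun e _ f _ hef => by simpa using hef)
  rw [Finset.prod_congr rfl fun e he => binomialRandom_real_notMem_edgeSet (hT e he),
    Finset.prod_const] at h
  rw [← h]
  congr 1
  ext G
  simp

end Probability

/-! ### Concentration and expansion -/

section Concentration

open scoped Classical

variable {V : Type*}

/-- The number of edges of `G` in `T`, as a sum of indicators. -/
noncomputable def edgeCount (T : Finset (Sym2 V)) : SimpleGraph V → ℝ :=
  ∑ e ∈ T, fun G => if e ∈ G.edgeSet then 1 else 0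

lemma edgeCount_apply (T : Finset (Sym2 V)) (G : SimpleGraph V) :
    edgeCount T G = ((T.filter fun e => e ∈ G.edgeSet).card : ℝ) := by
  simp [edgeCount]

/-- The pairs joining `x` to `S`. -/
noncomputable def starPairs (x : V) (S : Finset V) : Finset (Sym2 V) := S.image fun v => s(x, v)

lemma mk_right_injective (x : V) : Function.Injective fun v => s(x, v) :=
  fun _ _ h => Sym2.congr_right.1 h

lemma card_starPairs (x : V) (S : Finset V) : (starPairs x S).card = S.card :=
  Finset.card_image_of_injective _ (mk_right_injective x)

lemma starPairs_not_isDiag {x : V} {S : Finset V} (hx : x ∉ S) :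
    ∀ e ∈ starPairs x S, ¬ e.IsDiag := by
  intro e he
  obtain ⟨v, hv, rfl⟩ := Finset.mem_image.1 he
  rw [Sym2.mk_isDiag_iff]
  exact fun h => hx (h ▸ hv)

/-- The event that `z` has a neighbour in `A`. -/
def touches (z : V) (A : Finset V) : Set (SimpleGraph V) := {G | ∃ a ∈ A, G.Adj z a}

lemma dependsOn_touches (z : V) (A : Finset V) : DependsOn (touches z A) (starPairs z A) := by
  intro G H hGH
  refine exists_congr fun a => and_congr_right fun ha => ?_
  simpa using hGH s(z, a) (Finset.mem_image_of_mem _ ha)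

variable [Fintype V] {p : unitInterval}

lemma integrable_simpleGraph (f : SimpleGraph V → ℝ) :
    Integrable f (SimpleGraph.binomialRandom V p) := by
  have : DiscreteMeasurableSpace (SimpleGraph V) := ⟨measurableSet_simpleGraph⟩
  exact Integrable.of_finite

lemma mgf_edgeIndicator {e : Sym2 V} (he : ¬ e.IsDiag) (t : ℝ) :
    mgf (fun G : SimpleGraph V => if e ∈ G.edgeSet then (1 : ℝ) else 0)
      (SimpleGraph.binomialRandom V p) t = 1 + p * (Real.exp t - 1) := by
  have h : (fun G : SimpleGraph V => Real.exp (t * if e ∈ G.edgeSet then (1 : ℝ) else 0)) =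
      fun G => 1 + Set.indicator {G : SimpleGraph V | e ∈ G.edgeSet}
        (fun _ => Real.exp t - 1) G := by
    funext G
    by_cases hG : e ∈ G.edgeSet <;> simp [hG]
  rw [mgf, h, integral_add (integrable_simpleGraph _) (integrable_simpleGraph _),
    integral_indicator_const _ (measurableSet_simpleGraph _),
    binomialRandom_real_mem_edgeSet he]
  simp

lemma mgf_edgeCount_le {T : Finset (Sym2 V)} (hT : ∀ e ∈ T, ¬ e.IsDiag) {t : ℝ} (ht : |t| ≤ 1) :
    mgf (edgeCount T) (SimpleGraph.binomialRandom V p) t ≤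
      Real.exp (T.card * p * (t + t ^ 2)) := by
  have hind : iIndepFun (fun (e : Sym2 V) (G : SimpleGraph V) =>
      if e ∈ G.edgeSet then (1 : ℝ) else 0) (SimpleGraph.binomialRandom V p) := by
    have h := (iIndepFun_mem_edgeSet (V := V) (p := p)).comp
      (fun _ q => if q then (1 : ℝ) else 0) fun _ => measurable_of_countable _
    convert h using 3
    simp
  rw [edgeCount, hind.mgf_sum (fun _ => measurable_simpleGraph _),
    Finset.prod_congr rfl fun e he => mgf_edgeIndicator (hT e he) t, Finset.prod_const]
  have hp0 : (0 : ℝ) ≤ p := p.2.1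
  have hp1 : (p : ℝ) ≤ 1 := p.2.2
  have h1 : 1 + p * (Real.exp t - 1) ≤ Real.exp (p * (t + t ^ 2)) := by
    have h2 := (abs_le.1 (Real.abs_exp_sub_one_sub_id_le ht)).2
    have h3 := Real.add_one_le_exp ((p : ℝ) * (t + t ^ 2))
    have h4 : (p : ℝ) * (Real.exp t - 1) ≤ p * (t + t ^ 2) := by gcongr; linarith
    linarith
  have h0 : 0 ≤ 1 + p * (Real.exp t - 1) := by nlinarith [Real.exp_pos t]
  calc _ ≤ Real.exp (p * (t + t ^ 2)) ^ T.card := by gcongr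
    _ = _ := by rw [← Real.exp_nat_mul]; ring_nf

/-- Chernoff bound for the number of edges in a set of pairs. The parameter `M` dominates both the
mean and `L`, so that the optimal exponent `√(L / M)` is at most `1`. -/
lemma edgeCount_deviation {T : Finset (Sym2 V)} (hT : ∀ e ∈ T, ¬ e.IsDiag) {M L : ℝ} (hL : 0 < L)
    (hLM : L ≤ M) (hTM : T.card * (p : ℝ) ≤ M) :
    (SimpleGraph.binomialRandom V p).real
      {G | 7 * √(M * L) ≤ |edgeCount T G - T.card * p|} ≤ 2 * Real.exp (-(6 * L)) := by
  have hM : 0 < M := hL.trans_le hLM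
  set m : ℝ := T.card * p with hm
  set t : ℝ := √(L / M) with ht
  have ht0 : 0 ≤ t := Real.sqrt_nonneg _
  have ht1 : t ≤ 1 := Real.sqrt_le_one.2 ((div_le_one hM).2 hLM)
  have ht2 : M * t ^ 2 = L := by
    rw [ht, Real.sq_sqrt (by positivity)]; field_simp
  have htM : t * √(M * L) = L := by
    rw [ht, ← Real.sqrt_mul (by positivity)]
    have : L / M * (M * L) = L ^ 2 := by field_simp
    rw [this, Real.sqrt_sq hL.le]
  have hmt : m * t ^ 2 ≤ L := by
    rw [← ht2]; gcongr
  have hup : (SimpleGraph.binomialRandom V p).real {G | m + 7 * √(M * L) ≤ edgeCount T G} ≤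
      Real.exp (-(6 * L)) := by
    refine (measure_ge_le_exp_mul_mgf _ ht0 (integrable_simpleGraph _)).trans ?_
    refine (mul_le_mul_of_nonneg_left (mgf_edgeCount_le hT (abs_le.2 ⟨by linarith, ht1⟩))
      (Real.exp_pos _).le).trans ?_
    rw [← Real.exp_add, ← hm, Real.exp_le_exp]
    nlinarith
  have hlow : (SimpleGraph.binomialRandom V p).real {G | edgeCount T G ≤ m - 7 * √(M * L)} ≤
      Real.exp (-(6 * L)) := by
    refine (measure_le_le_exp_mul_mgf _ (neg_nonpos.2 ht0) (integrable_simpleGraph _)).trans ?_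
    refine (mul_le_mul_of_nonneg_left (mgf_edgeCount_le hT (abs_le.2 ⟨by linarith, by linarith⟩))
      (Real.exp_pos _).le).trans ?_
    rw [← Real.exp_add, ← hm, Real.exp_le_exp]
    nlinarith
  calc _ ≤ (SimpleGraph.binomialRandom V p).real ({G | m + 7 * √(M * L) ≤ edgeCount T G} ∪
        {G | edgeCount T G ≤ m - 7 * √(M * L)}) := by
        refine measureReal_mono fun G hG => ?_
        rcases le_abs'.1 (Set.mem_ofPred_eq ▸ hG : _ ≤ |_|) with h | h
        · exact Or.inr (by simp only [Set.mem_ofPred_eq]; linarith)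
        · exact Or.inl (by simp only [Set.mem_ofPred_eq]; linarith)
    _ ≤ _ := measureReal_union_le _ _
    _ ≤ _ := by linarith

lemma edgeCount_starPairs (x : V) (S : Finset V) (G : SimpleGraph V) :
    edgeCount (starPairs x S) G = ((G.neighborFinset x ∩ S).card : ℝ) := by
  rw [edgeCount_apply, starPairs, Finset.filter_image,
    Finset.card_image_of_injective _ (mk_right_injective x)]
  congr 2
  ext v
  simp [and_comm]

lemma dependsOn_of_deleteIncidenceSet {β : Type*} (h : SimpleGraph V → β) (x : V) (b : β) :
    DependsOn {G | h (G.deleteIncidenceSet x) = b} (Finset.univ.filter fun e => x ∉ e) := by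
  intro G H hGH
  have : G.deleteIncidenceSet x = H.deleteIncidenceSet x := by
    ext u v
    simp only [SimpleGraph.deleteIncidenceSet_adj]
    refine and_congr_left fun huv => ?_
    have := hGH s(u, v) (by simp [huv.1.symm, huv.2.symm])
    simpa using this
  simp [this]

/-- The neighbourhood of `x` is independent of `G - x`; hence the number of neighbours of `x` in a
set which is determined by `G - x` concentrates around `p` times the size of the set. -/
lemma neighbor_deviation (x : V) (h : SimpleGraph V → Finset V) (hx : ∀ H, x ∉ h H) {M L : ℝ}
    (hL : 0 < L) (hLM : L ≤ M) (hM : Fintype.card V * (p : ℝ) ≤ M) :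
    (SimpleGraph.binomialRandom V p).real
      {G | 7 * √(M * L) ≤ |((G.neighborFinset x ∩ h (G.deleteIncidenceSet x)).card : ℝ) -
        (h (G.deleteIncidenceSet x)).card * p|} ≤ 2 * Real.exp (-(6 * L)) := by
  set μ := SimpleGraph.binomialRandom V p
  set E : Finset V → Set (SimpleGraph V) := fun S => {G | h (G.deleteIncidenceSet x) = S} with hE
  set F : Finset V → Set (SimpleGraph V) := fun S =>
    {G | 7 * √(M * L) ≤ |edgeCount (starPairs x S) G - (starPairs x S).card * p|} with hF
  have hFdep : ∀ S, DependsOn (F S) (starPairs x S) := by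
    intro S G H hGH
    have : edgeCount (starPairs x S) G = edgeCount (starPairs x S) H := by
      rw [edgeCount_apply, edgeCount_apply, Finset.filter_congr hGH]
    simp [hF, this]
  have hF2 : ∀ S, x ∉ S → μ.real (F S) ≤ 2 * Real.exp (-(6 * L)) := by
    intro S hS
    refine edgeCount_deviation (starPairs_not_isDiag hS) hL hLM (le_trans ?_ hM)
    rw [card_starPairs]
    exact mul_le_mul_of_nonneg_right (by exact_mod_cast Finset.card_le_univ S) p.2.1
  have hEF : ∀ S, μ.real (E S ∩ F S) ≤ μ.real (E S) * (2 * Real.exp (-(6 * L))) := by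
    intro S
    by_cases hS : x ∈ S
    · have : E S = ∅ := by
        ext G
        simp only [hE, Set.mem_ofPred_eq, Set.mem_empty_iff_false, iff_false]
        exact fun e => hx _ (e ▸ hS)
      simp [this]
    · have hdisj : Disjoint (Finset.univ.filter fun e : Sym2 V => x ∉ e) (starPairs x S) := by
        rw [Finset.disjoint_left]
        intro e he he'
        obtain ⟨v, -, rfl⟩ := Finset.mem_image.1 he'
        simp at he
      rw [(dependsOn_of_deleteIncidenceSet h x S).real_inter (hFdep S) hdisj]
      exact mul_le_mul_of_nonneg_left (hF2 S hS) measureReal_nonneg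
  have hsum : ∑ S, μ.real (E S) = 1 := by
    have := sum_measureReal_preimage_singleton (μ := μ) (Finset.univ : Finset (Finset V))
      (f := fun G => h (G.deleteIncidenceSet x)) fun _ _ => measurableSet_simpleGraph _
    rw [Finset.coe_univ, Set.preimage_univ, probReal_univ] at this
    rw [← this]
    refine Finset.sum_congr rfl fun S _ => congrArg _ ?_
    ext G
    simp [hE]
  calc _ ≤ μ.real (⋃ S, E S ∩ F S) := by
        refine measureReal_mono fun G hG => Set.mem_iUnion.2 ⟨h (G.deleteIncidenceSet x), rfl, ?_⟩
        simpa only [hF, Set.mem_ofPred_eq, edgeCount_starPairs, card_starPairs] using hG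
    _ ≤ ∑ S, μ.real (E S ∩ F S) := measureReal_iUnion_fintype_le _
    _ ≤ ∑ S, μ.real (E S) * (2 * Real.exp (-(6 * L))) := Finset.sum_le_sum fun S _ => hEF S
    _ = _ := by rw [← Finset.sum_mul, hsum, one_mul]

/-- Union bound over pairs of disjoint `s`-sets of vertices. -/
lemma exists_pair_le {s : ℕ} (hs : 1 ≤ s) {L : ℝ} (hL : 0 ≤ L)
    (hcard : (Fintype.card V : ℝ) = Real.exp L) (R : Finset V → Finset V → Set (SimpleGraph V))
    (hR : ∀ A B : Finset V, Disjoint A B → A.card = s → B.card = s →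
      (SimpleGraph.binomialRandom V p).real (R A B) ≤ Real.exp (-(7 * s * L))) :
    (SimpleGraph.binomialRandom V p).real
      {G | ∃ A B : Finset V, Disjoint A B ∧ A.card = s ∧ B.card = s ∧ G ∈ R A B} ≤
        Real.exp (-(5 * L)) := by
  set I := Finset.powersetCard s (Finset.univ : Finset V) with hI
  set P := (I ×ˢ I).filter fun q => Disjoint q.1 q.2 with hP
  have hIc : (I.card : ℝ) ≤ Real.exp (s * L) := by
    rw [hI, Finset.card_powersetCard, Finset.card_univ, Real.exp_nat_mul, ← hcard]
    exact_mod_cast Nat.choose_le_pow _ _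
  have hPc : (P.card : ℝ) ≤ Real.exp (s * L) * Real.exp (s * L) := by
    calc (P.card : ℝ) ≤ ((I ×ˢ I).card : ℝ) := by exact_mod_cast Finset.card_filter_le _ _
      _ = I.card * I.card := by rw [Finset.card_product]; push_cast; ring
      _ ≤ _ := by gcongr
  calc _ ≤ (SimpleGraph.binomialRandom V p).real (⋃ q ∈ P, R q.1 q.2) := by
        refine measureReal_mono ?_ (measure_ne_top _ _)
        rintro G ⟨A, B, hAB, hA, hB, hG⟩
        simp only [Set.mem_iUnion]
        exact ⟨(A, B), by simp [hP, hI, Finset.mem_powersetCard, hA, hB, hAB], hG⟩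
    _ ≤ ∑ q ∈ P, (SimpleGraph.binomialRandom V p).real (R q.1 q.2) :=
        measureReal_biUnion_finset_le _ _
    _ ≤ ∑ q ∈ P, Real.exp (-(7 * s * L)) := by
        refine Finset.sum_le_sum fun q hq => ?_
        simp only [hP, hI, Finset.mem_filter, Finset.mem_product, Finset.mem_powersetCard] at hq
        exact hR _ _ hq.2 hq.1.1.2 hq.1.2.2
    _ = P.card * Real.exp (-(7 * s * L)) := by simp
    _ ≤ Real.exp (s * L) * Real.exp (s * L) * Real.exp (-(7 * s * L)) := by gcongr
    _ = Real.exp (-(5 * (s * L))) := by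
        rw [← Real.exp_add, ← Real.exp_add]; congr 1; ring
    _ ≤ _ := by
        rw [Real.exp_le_exp]
        have : (1 : ℝ) ≤ s := by exact_mod_cast hs
        nlinarith

/-- Any two disjoint sets of `s` vertices are joined by an edge. -/
def EdgeExpanding (G : SimpleGraph V) (s : ℕ) : Prop :=
  ∀ A B : Finset V, Disjoint A B → A.card = s → B.card = s → ∃ a ∈ A, ∃ b ∈ B, G.Adj a b

/-- Any two disjoint sets of `s` vertices are joined by a path of length two. -/
def PathExpanding (G : SimpleGraph V) (s : ℕ) : Prop :=
  ∀ A B : Finset V, Disjoint A B → A.card = s → B.card = s →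
    ∃ a ∈ A, ∃ b ∈ B, ∃ z, G.Adj a z ∧ G.Adj z b

lemma one_sub_pow_le_exp (p : unitInterval) (m : ℕ) :
    (1 - p : ℝ) ^ m ≤ Real.exp (-(m * p)) := by
  have h1 : (0 : ℝ) ≤ 1 - p := by linarith [p.2.2]
  have h2 : 1 - (p : ℝ) ≤ Real.exp (-p) := by linarith [Real.add_one_le_exp (-(p : ℝ))]
  calc _ ≤ Real.exp (-p) ^ m := by gcongr
    _ = _ := by rw [← Real.exp_nat_mul]; ring_nf

lemma not_edgeExpanding_le {s : ℕ} (hs : 1 ≤ s) {L : ℝ} (hL : 0 ≤ L)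
    (hcard : (Fintype.card V : ℝ) = Real.exp L) (hps : 7 * L ≤ p * s) :
    (SimpleGraph.binomialRandom V p).real {G | ¬ EdgeExpanding G s} ≤ Real.exp (-(5 * L)) := by
  have h := exists_pair_le (p := p) hs hL hcard
    (fun A B => {G | ∀ e ∈ (A ×ˢ B).image fun q => s(q.1, q.2), e ∉ G.edgeSet}) ?_
  · refine le_trans (measureReal_mono ?_) h
    intro G hG
    simp only [EdgeExpanding, Set.mem_ofPred_eq, not_forall, not_exists, not_and] at hG
    obtain ⟨A, B, hAB, hA, hB, hno⟩ := hG
    refine ⟨A, B, hAB, hA, hB, ?_⟩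
    intro e he
    obtain ⟨q, hq, rfl⟩ := Finset.mem_image.1 he
    rw [Finset.mem_product] at hq
    exact hno _ hq.1 _ hq.2
  · intro A B hAB hA hB
    rw [binomialRandom_real_forall_notMem, Finset.card_image_of_injOn, Finset.card_product, hA, hB]
    · refine (one_sub_pow_le_exp p _).trans ?_
      rw [Real.exp_le_exp]
      push_cast
      have : (0 : ℝ) ≤ s := Nat.cast_nonneg s
      nlinarith
    · rintro ⟨a, b⟩ hq ⟨a', b'⟩ hq' he
      simp only [Finset.coe_product, Set.mem_prod, Finset.mem_coe] at hq hq'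
      rcases Sym2.eq_iff.1 he with ⟨h1, h2⟩ | ⟨h1, h2⟩
      · exact Prod.ext h1 h2
      · simp only at h1
        exact absurd (h1 ▸ hq.1 : b' ∈ A) (Finset.disjoint_right.1 hAB hq'.2)
    · intro e he
      obtain ⟨q, hq, rfl⟩ := Finset.mem_image.1 he
      rw [Finset.mem_product] at hq
      rw [Sym2.mk_isDiag_iff]
      exact fun h => Finset.disjoint_left.1 hAB hq.1 (h ▸ hq.2)

lemma le_real_touches {z : V} {A : Finset V} (hz : z ∉ A) (hA : A.card * (p : ℝ) ≤ 1) :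
    A.card * (p : ℝ) / 2 ≤ (SimpleGraph.binomialRandom V p).real (touches z A) := by
  have h1 : (touches z A)ᶜ = {G | ∀ e ∈ starPairs z A, e ∉ G.edgeSet} := by
    ext G
    simp [touches, starPairs]
  have h2 := binomialRandom_real_forall_notMem (p := p) (starPairs_not_isDiag hz)
  rw [← h1, probReal_compl_eq_one_sub (measurableSet_simpleGraph _), card_starPairs] at h2
  have h3 := one_sub_pow_le_exp p A.card
  set t : ℝ := A.card * (p : ℝ) with ht
  have ht0 : 0 ≤ t := mul_nonneg (Nat.cast_nonneg _) p.2.1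
  have h4 : Real.exp (-t) ≤ 1 - t / 2 := by
    have := abs_le.1 (Real.abs_exp_sub_one_sub_id_le (x := -t)
      (by rw [abs_neg, abs_of_nonneg ht0]; exact hA))
    have h5 := Real.add_one_le_exp t
    rw [Real.exp_neg]
    rw [inv_le_comm₀ (Real.exp_pos _) (by linarith)]
    refine le_trans ?_ h5
    rw [inv_le_comm₀ (by linarith) (by linarith), inv_le_iff_one_le_mul₀ (by linarith)]
    nlinarith
  linarith

lemma not_pathExpanding_le {s : ℕ} (hs : 1 ≤ s) {L : ℝ} (hL : 0 ≤ L)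
    (hcard : (Fintype.card V : ℝ) = Real.exp L) (hsp : s * (p : ℝ) ≤ 1)
    (hsn : 4 * (s : ℝ) ≤ Fintype.card V) (hps : 56 * L ≤ Fintype.card V * (p : ℝ) ^ 2 * s) :
    (SimpleGraph.binomialRandom V p).real {G | ¬ PathExpanding G s} ≤ Real.exp (-(5 * L)) := by
  set μ := SimpleGraph.binomialRandom V p
  have h := exists_pair_le (p := p) hs hL hcard
    (fun A B => ⋂ z ∈ (A ∪ B)ᶜ, (touches z A ∩ touches z B)ᶜ) ?_
  · refine le_trans (measureReal_mono ?_) h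
    intro G hG
    simp only [PathExpanding, Set.mem_ofPred_eq, not_forall, not_exists, not_and] at hG
    obtain ⟨A, B, hAB, hA, hB, hno⟩ := hG
    refine ⟨A, B, hAB, hA, hB, ?_⟩
    simp only [Set.mem_iInter]
    rintro z - ⟨⟨a, ha, hza⟩, ⟨b, hb, hzb⟩⟩
    exact hno a ha b hb z hza.symm hzb
  · intro A B hAB hA hB
    have hdep : ∀ z ∈ (A ∪ B)ᶜ, DependsOn (touches z A ∩ touches z B)ᶜ
        (starPairs z A ∪ starPairs z B) := fun z _ G H hGH =>
      not_congr (((dependsOn_touches z A).inter (dependsOn_touches z B)) G H hGH)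
    have hstar : ∀ z, starPairs z A ∪ starPairs z B = starPairs z (A ∪ B) := fun z => by
      rw [starPairs, starPairs, starPairs, Finset.image_union]
    rw [DependsOn.real_biInter hdep]
    · have hz : ∀ z ∈ (A ∪ B)ᶜ, μ.real (touches z A ∩ touches z B)ᶜ ≤
          Real.exp (-((s * p) ^ 2 / 4)) := by
        intro z hz
        simp only [Finset.mem_compl, Finset.mem_union, not_or] at hz
        have hd : Disjoint (starPairs z A) (starPairs z B) := by
          rw [starPairs, starPairs,
            Finset.disjoint_image (mk_right_injective z)]
          exact hAB
        rw [probReal_compl_eq_one_sub (measurableSet_simpleGraph _),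
          (dependsOn_touches z A).real_inter (dependsOn_touches z B) hd]
        have h1 := le_real_touches (p := p) hz.1 (by rw [hA]; exact hsp)
        have h2 := le_real_touches (p := p) hz.2 (by rw [hB]; exact hsp)
        rw [hA] at h1
        rw [hB] at h2
        have h0 : 0 ≤ s * (p : ℝ) / 2 := by have := p.2.1; positivity
        have h3 := mul_le_mul h1 h2 h0 (h0.trans h1)
        have h4 := Real.add_one_le_exp (-((s * p : ℝ) ^ 2 / 4))
        nlinarith
      have hcompl : (Fintype.card V : ℝ) / 2 ≤ ((A ∪ B)ᶜ.card : ℝ) := by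
        rw [Finset.card_compl, Nat.cast_sub (Finset.card_le_univ _),
          Finset.card_union_of_disjoint hAB, hA, hB]
        push_cast
        linarith
      calc _ ≤ ∏ z ∈ (A ∪ B)ᶜ, Real.exp (-((s * p) ^ 2 / 4)) :=
            Finset.prod_le_prod (fun _ _ => measureReal_nonneg) hz
        _ = Real.exp (-((A ∪ B)ᶜ.card * ((s * p) ^ 2 / 4))) := by
            rw [Finset.prod_const, ← Real.exp_nat_mul]; ring_nf
        _ ≤ _ := by
            rw [Real.exp_le_exp, neg_le_neg_iff]
            calc 7 * s * L = s * (56 * L) / 8 := by ring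
              _ ≤ s * (Fintype.card V * (p : ℝ) ^ 2 * s) / 8 := by gcongr
              _ = (Fintype.card V : ℝ) / 2 * ((s * p) ^ 2 / 4) := by ring
              _ ≤ _ := by gcongr
    · intro z hz w hw hzw
      simp only [Function.onFun, hstar]
      rw [Finset.disjoint_left]
      intro e he he'
      obtain ⟨a, ha, rfl⟩ := Finset.mem_image.1 he
      obtain ⟨b, hb, hab⟩ := Finset.mem_image.1 he'
      rcases Sym2.eq_iff.1 hab with ⟨h1, -⟩ | ⟨h1, -⟩
      · exact hzw h1.symm
      · exact (Finset.mem_compl.1 (Finset.mem_coe.1 hw)) (h1 ▸ ha)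

end Concentration

/-! ### Curvature of a typical edge -/

section Typical

open scoped Classical

variable {V : Type*} [Fintype V] {G : SimpleGraph V} {x y : V}

/-- The degrees of `G`, and the numbers of neighbours of `x` in the balls of radius at most `3`
around `y` in `G - x`, are close to their expected values; here `d` is the expected degree and `w`
the scale of the fluctuations. -/
structure Typical (G : SimpleGraph V) (x y : V) (p d w : ℝ) : Prop where
  degree_dev : ∀ v, |(G.degree v : ℝ) - d| ≤ 8 * w
  near_dev : ∀ r ∈ ({1, 2, 3} : Finset ℕ),
    |(nearCount G x y r : ℝ) - (ballAvoiding G x y r).card * p| ≤ 7 * w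

variable {p d w : ℝ}

/-- The scale of the fluctuations is at least `1` and small compared with the expected degree. -/
structure Scale (p d w : ℝ) : Prop where
  p_nonneg : 0 ≤ p
  p_le_one : p ≤ 1
  one_le : 1 ≤ w
  le_degree : 16 * w ≤ d

lemma Scale.d_pos (hs : Scale p d w) : 0 < d := by linarith [hs.one_le, hs.le_degree]

lemma Typical.degree_ge (h : Typical G x y p d w) (hs : Scale p d w) (v : V) :
    d / 2 ≤ (G.degree v : ℝ) := by
  linarith [(abs_le.1 (h.degree_dev v)).1, hs.le_degree]

lemma Typical.degree_le (h : Typical G x y p d w) (hs : Scale p d w) (v : V) :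
    (G.degree v : ℝ) ≤ 3 / 2 * d := by
  linarith [(abs_le.1 (h.degree_dev v)).2, hs.le_degree]

lemma Typical.div_degree_le (h : Typical G x y p d w) (hs : Scale p d w) (v : V) {a : ℝ}
    (ha : 0 ≤ a) : a / G.degree v ≤ 2 * a / d := by
  have hd := hs.d_pos
  have := h.degree_ge hs v
  rw [div_le_div_iff₀ (by linarith) hd]
  nlinarith

lemma Typical.nearCount_le (h : Typical G x y p d w) (hs : Scale p d w) {r : ℕ}
    (hr : r ∈ ({1, 2, 3} : Finset ℕ)) : (nearCount G x y r : ℝ) ≤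
      (3 * d) ^ r * p + 7 * w := by
  have h1 := (abs_le.1 (h.near_dev r hr)).2
  have h2 := card_ballAvoiding_le (x := x) (y := y) (h.degree_le hs) r
  have h3 : (1 + 3 / 2 * d) ^ r ≤ (3 * d) ^ r := by
    have := hs.one_le
    have := hs.le_degree
    have := hs.d_pos
    gcongr
    linarith
  have h4 := mul_le_mul_of_nonneg_right (h2.trans h3) hs.p_nonneg
  linarith

/-- The common error terms of the lower bounds on the curvature. -/
lemma Typical.error_le (h : Typical G x y p d w) (hs : Scale p d w) (s : ℕ) :
    4 * |(G.degree x : ℝ) - G.degree y| / G.degree y +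
      4 * s * (1 / G.degree x + 1 / G.degree y) ≤ 128 * (w / d) + 16 * (s / d) := by
  have h1 : |(G.degree x : ℝ) - G.degree y| ≤ 16 * w := by
    have := abs_le.1 (h.degree_dev x)
    have := abs_le.1 (h.degree_dev y)
    exact abs_le.2 ⟨by linarith, by linarith⟩
  have h2 := h.div_degree_le hs y (a := 4 * |(G.degree x : ℝ) - G.degree y|) (by positivity)
  have h3 := h.div_degree_le hs x (a := 4 * (s : ℝ)) (by positivity)
  have h4 := h.div_degree_le hs y (a := 4 * (s : ℝ)) (by positivity)
  have hd := hs.d_pos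
  have h5 : 2 * (4 * |(G.degree x : ℝ) - G.degree y|) / d ≤ 128 * (w / d) := by
    rw [← mul_div_assoc]
    exact div_le_div_of_nonneg_right (by linarith) hd.le
  have e1 : 4 * (s : ℝ) * (1 / G.degree x + 1 / G.degree y) =
    4 * s / G.degree x + 4 * s / G.degree y := by ring
  have e2 : 2 * (4 * (s : ℝ)) / d = 8 * (s / d) := by ring
  rw [e1]
  linarith

/-- Triangles determine the curvature up to the error of an almost perfect matching. -/
lemma Typical.curvature_edgeExpanding (h : Typical G x y p d w) (hs : Scale p d w)
    (hxy : G.Adj x y) {s : ℕ} (hexp : EdgeExpanding G s) :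
    ∃ k, HasRicciCurvature G x y k ∧ |k - p| ≤ 144 * (w / d) + 16 * (s / d) := by
  obtain ⟨k, hk, hup, hlow⟩ := exists_hasRicciCurvature hxy
  refine ⟨k, hk, ?_⟩
  have hd := hs.d_pos
  have hw := hs.one_le
  have hdx := degree_pos_real hxy
  have hdy := degree_pos_real hxy.symm
  have hnear := abs_le.1 (h.near_dev 1 (by simp))
  rw [card_ballAvoiding_one hxy] at hnear
  have hs0 : (0 : ℝ) ≤ s / d := by positivity
  have hw0 : 0 ≤ w / d := by positivity
  rw [abs_le]
  constructor
  · set C := G.neighborFinset x ∩ G.neighborFinset y with hC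
    have hcard : (C.card : ℝ) = nearCount G x y 1 - 1 := by
      rw [nearCount_one hxy]; push_cast; ring
    have hlow' := hlow (C.card / G.degree y - (128 * (w / d) + 16 * (s / d))) fun f hf => by
      have := neighborAvg_sub_le_of_hole hf hxy (C := C) Finset.inter_subset_left
        Finset.inter_subset_right (r := 1) s (by norm_num) (by norm_num)
        fun A hA B hB hAs hBs => by
          have hdisj : Disjoint A B := by
            rw [Finset.disjoint_left]
            intro v hvA hvB
            have h1 := Finset.mem_sdiff.1 (hA hvA)
            have h2 := Finset.mem_sdiff.1 (hB hvB)
            exact h1.2 (Finset.mem_inter.2 ⟨h1.1, h2.1⟩)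
          obtain ⟨a, ha, b, hb, hab⟩ := hexp A B hdisj hAs hBs
          exact ⟨a, ha, b, hb, by linarith [(abs_le.1 (hf.abs_sub_le_one hab)).2]⟩
      linarith [h.error_le hs s]
    have h1 : p - 16 * (w / d) ≤ C.card / G.degree y := by
      have h2 := h.div_degree_le hs y (a := 8 * w) (by linarith)
      have h3 : p - 8 * w / G.degree y ≤ C.card / G.degree y := by
        rw [sub_le_iff_le_add, ← add_div, le_div_iff₀ hdy]
        linarith
      have e : 2 * (8 * w) / d = 16 * (w / d) := by ring
      linarith
    linarith
  · obtain ⟨f, hf, hf1, hfb⟩ := exists_test_triangles hxy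
    have h1 := (hup f hf hf1).trans hfb
    have h2 := h.div_degree_le hs x (a := 23 * w) (by linarith)
    have h3 := h.div_degree_le hs y (a := 1) (by norm_num)
    have h4 : nearCount G x y 1 / G.degree x ≤ p + 23 * w / G.degree x := by
      rw [← sub_le_iff_le_add, ← sub_div, div_le_iff₀ hdx]
      have h5 : (G.degree y : ℝ) * p ≤ G.degree x * p + 16 * w := by
        have h6 := abs_le.1 (h.degree_dev x)
        have h7 := abs_le.1 (h.degree_dev y)
        have h8 : ((G.degree y : ℝ) - G.degree x) * p ≤ 16 * w * 1 :=
          (mul_le_mul_of_nonneg_right (by linarith) hs.p_nonneg).trans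
            (mul_le_mul_of_nonneg_left hs.p_le_one (by linarith))
        linarith
      linarith
    have e1 : 2 * (23 * w) / d = 46 * (w / d) := by ring
    have e2 : 2 * 1 / d ≤ 2 * (w / d) := by
      rw [← mul_div_assoc]; gcongr
    linarith

/-- If few squares pass through the edge `xy`, but most neighbours of `x` and `y` can be matched
along paths of length two, then the curvature is close to `-1`. -/
lemma Typical.curvature_pathExpanding (h : Typical G x y p d w) (hs : Scale p d w)
    (hxy : G.Adj x y) {s : ℕ} (hexp : PathExpanding G s) :
    ∃ k, HasRicciCurvature G x y k ∧
      |k - (-1)| ≤ 36 * (d * p) + 128 * (w / d) + 16 * (s / d) := by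
  obtain ⟨k, hk, hup, hlow⟩ := exists_hasRicciCurvature hxy
  refine ⟨k, hk, ?_⟩
  have hd := hs.d_pos
  have hw := hs.one_le
  have hs0 : (0 : ℝ) ≤ s / d := by positivity
  have hw0 : 0 ≤ w / d := by positivity
  have hp0 : 0 ≤ d * p := mul_nonneg hd.le hs.p_nonneg
  rw [abs_le]
  constructor
  · have := hlow (-1 - (128 * (w / d) + 16 * (s / d))) fun f hf => by
      have := neighborAvg_sub_le_of_hole hf hxy (C := ∅) (by simp) (by simp) (r := 2) s
        (by norm_num) (by norm_num) fun A hA B hB hAs hBs => by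
          by_cases hdisj : Disjoint A B
          · obtain ⟨a, ha, b, hb, z, haz, hzb⟩ := hexp A B hdisj hAs hBs
            exact ⟨a, ha, b, hb, by linarith [(abs_le.1 (hf.abs_sub_le_one haz)).2,
              (abs_le.1 (hf.abs_sub_le_one hzb)).2]⟩
          · obtain ⟨a, ha, hb⟩ := Finset.not_disjoint_iff.1 hdisj
            exact ⟨a, ha, a, hb, by linarith⟩
      simp only [Finset.card_empty, Nat.cast_zero, zero_div, sub_zero] at this
      linarith [h.error_le hs s]
    linarith
  · obtain ⟨f, hf, hf1, hfb⟩ := exists_test_squares hxy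
    have h1 := (hup f hf hf1).trans hfb
    have h2 := h.div_degree_le hs x (a := 2 * nearCount G x y 2) (by positivity)
    have h3 := h.div_degree_le hs y (a := 1) (by norm_num)
    have h4 : 2 * (2 * (nearCount G x y 2 : ℝ)) / d ≤ 36 * (d * p) + 28 * (w / d) := by
      have h5 := h.nearCount_le hs (r := 2) (by simp)
      have e : 36 * (d * p) + 28 * (w / d) = 2 * (2 * ((3 * d) ^ 2 * p + 7 * w)) / d := by
        field_simp
        ring
      rw [e]
      gcongr
    have e2 : 2 * 1 / d ≤ 2 * (w / d) := by
      rw [← mul_div_assoc]; gcongr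
    linarith

/-- If few pentagons pass through the edge `xy`, then the curvature is close to `-2`, the least
possible value. -/
lemma Typical.curvature_sparse (h : Typical G x y p d w) (hs : Scale p d w) (hxy : G.Adj x y) :
    ∃ k, HasRicciCurvature G x y k ∧ |k - (-2)| ≤ 270 * (d ^ 2 * p) + 70 * (w / d) := by
  obtain ⟨k, hk, hup, hlow⟩ := exists_hasRicciCurvature hxy
  refine ⟨k, hk, ?_⟩
  have hd := hs.d_pos
  have hw := hs.one_le
  have hw0 : 0 ≤ w / d := by positivity
  have hp0 : 0 ≤ d ^ 2 * p := mul_nonneg (by positivity) hs.p_nonneg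
  rw [abs_le]
  constructor
  · have := hlow (-2) fun f hf => by linarith [hf.neighborAvg_sub_le_three hxy]
    linarith
  · obtain ⟨f, hf, hf1, hfb⟩ := exists_test_pentagons hxy
    have h1 := (hup f hf hf1).trans hfb
    have h2 := h.div_degree_le hs x (a := 2 * nearCount G x y 3) (by positivity)
    have h3 := h.div_degree_le hs y (a := 3 * nearCount G x y 1) (by positivity)
    have h13 : (nearCount G x y 1 : ℝ) ≤ nearCount G x y 3 := by
      exact_mod_cast nearCount_mono (G := G) (x := x) (y := y) (show 1 ≤ 3 by norm_num)
    have h4 : 2 * (2 * (nearCount G x y 3 : ℝ)) / d + 2 * (3 * nearCount G x y 1) / d ≤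
        270 * (d ^ 2 * p) + 70 * (w / d) := by
      have h5 := h.nearCount_le hs (r := 3) (by simp)
      have e : 270 * (d ^ 2 * p) + 70 * (w / d) = 10 * ((3 * d) ^ 3 * p + 7 * w) / d := by
        field_simp
        ring
      rw [e, ← add_div]
      refine div_le_div_of_nonneg_right ?_ hd.le
      linarith
    linarith

end Typical

/-! ### Probability that an edge is not typical -/

section Typical

open scoped Classical

variable {V : Type*} [Fintype V] {x y : V} {p : unitInterval} {L : ℝ}

lemma scale_sqrt {d : ℝ} (hL : 1 ≤ L) (hd : 256 * L ≤ d) : Scale (p : ℝ) d √(d * L) where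
  p_nonneg := p.2.1
  p_le_one := p.2.2
  one_le := Real.one_le_sqrt.2 (by nlinarith)
  le_degree := by
    have : √(d * L) ≤ d / 16 := Real.sqrt_le_iff.2 ⟨by linarith, by nlinarith⟩
    linarith

lemma sqrt_mul_div_self {d : ℝ} (hd : 0 < d) (L : ℝ) : √(d * L) / d = √(L / d) := by
  rw [Real.sqrt_mul hd.le, Real.sqrt_div' _ hd.le, mul_div_right_comm, Real.sqrt_div_self]
  ring

/-- A pair `x ≠ y` is typical up to probability `O(n ^ (-5))`. -/
lemma not_typical_le (hxy : x ≠ y) (hL : 1 ≤ L) (hcard : (Fintype.card V : ℝ) = Real.exp L)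
    (hd : 256 * L ≤ Fintype.card V * (p : ℝ)) :
    (SimpleGraph.binomialRandom V p).real {G | ¬ Typical G x y p (Fintype.card V * p)
      √(Fintype.card V * p * L)} ≤ 8 * Real.exp (-(5 * L)) := by
  set μ := SimpleGraph.binomialRandom V p
  set d : ℝ := Fintype.card V * (p : ℝ) with hdd
  have hsc := scale_sqrt (p := p) hL hd
  set w : ℝ := √(d * L) with hw
  have hLd : L ≤ d := by linarith
  set E : V → Set (SimpleGraph V) := fun v => {G | 8 * w < |(G.degree v : ℝ) - d|} with hE
  set F : ℕ → Set (SimpleGraph V) := fun r =>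
    {G | 7 * w < |(nearCount G x y r : ℝ) - (ballAvoiding G x y r).card * p|} with hF
  have hEle : ∀ v, μ.real (E v) ≤ 2 * Real.exp (-(6 * L)) := by
    intro v
    refine le_trans (measureReal_mono ?_) (neighbor_deviation v (fun _ => Finset.univ.erase v)
      (by simp) (by linarith) hLd le_rfl)
    intro G hG
    have h1 : G.neighborFinset v ∩ Finset.univ.erase v = G.neighborFinset v := by
      ext u
      simp only [Finset.mem_inter, SimpleGraph.mem_neighborFinset, Finset.mem_erase,
        Finset.mem_univ, and_true, and_iff_left_iff_imp]
      exact fun h => h.ne'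
    have h2 : (((Finset.univ : Finset V).erase v).card : ℝ) = Fintype.card V - 1 := by
      rw [Finset.card_erase_of_mem (Finset.mem_univ v), Finset.card_univ,
        Nat.cast_sub (Fintype.card_pos_iff.2 ⟨v⟩)]
      simp
    simp only [hE, Set.mem_ofPred_eq] at hG ⊢
    rw [h1, h2, SimpleGraph.card_neighborFinset_eq_degree]
    -- the mean degree is `(n - 1) p`, which differs from `d = n p` by at most `1 ≤ w`
    have h3 : |(G.degree v : ℝ) - d| ≤ |(G.degree v : ℝ) - (Fintype.card V - 1) * p| + 1 := by
      have e : (G.degree v : ℝ) - d = ((G.degree v : ℝ) - (Fintype.card V - 1) * p) - p := by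
        rw [hdd]; ring
      rw [e]
      refine (abs_sub _ _).trans ?_
      rw [abs_of_nonneg p.2.1]
      linarith [p.2.2]
    linarith [hsc.one_le]
  have hFle : ∀ r, μ.real (F r) ≤ 2 * Real.exp (-(6 * L)) := by
    intro r
    refine le_trans (measureReal_mono ?_) (neighbor_deviation x (fun H => (ball H y r).erase x)
      (by simp) (by linarith) hLd le_rfl)
    intro G hG
    have h1 : (ball (G.deleteIncidenceSet x) y r).erase x = ballAvoiding G x y r :=
      Finset.erase_eq_of_notMem (notMem_ballAvoiding hxy r)
    simp only [hF, Set.mem_ofPred_eq] at hG ⊢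
    rw [h1]
    exact hG.le
  have hexp : Real.exp (-(6 * L)) * Fintype.card V = Real.exp (-(5 * L)) := by
    rw [hcard, ← Real.exp_add]; congr 1; ring
  have hexp2 : Real.exp (-(6 * L)) ≤ Real.exp (-(5 * L)) := Real.exp_le_exp.2 (by linarith)
  calc _ ≤ μ.real ((⋃ v, E v) ∪ ⋃ r ∈ ({1, 2, 3} : Finset ℕ), F r) := by
        refine measureReal_mono fun G hG => ?_
        by_contra hcon
        simp only [Set.mem_union, Set.mem_iUnion, not_or, not_exists, hE, hF,
          Set.mem_ofPred_eq, not_lt] at hcon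
        exact hG ⟨hcon.1, fun r hr => hcon.2 r hr⟩
    _ ≤ μ.real (⋃ v, E v) + μ.real (⋃ r ∈ ({1, 2, 3} : Finset ℕ), F r) :=
        measureReal_union_le _ _
    _ ≤ ∑ v, μ.real (E v) + ∑ r ∈ ({1, 2, 3} : Finset ℕ), μ.real (F r) :=
        add_le_add (measureReal_iUnion_fintype_le _) (measureReal_biUnion_finset_le _ _)
    _ ≤ ∑ _v : V, 2 * Real.exp (-(6 * L)) +
          ∑ _r ∈ ({1, 2, 3} : Finset ℕ), 2 * Real.exp (-(6 * L)) :=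
        add_le_add (Finset.sum_le_sum fun v _ => hEle v) (Finset.sum_le_sum fun r _ => hFle r)
    _ ≤ _ := by
        rw [Finset.sum_const, Finset.sum_const, Finset.card_univ, nsmul_eq_mul, nsmul_eq_mul,
          show (({1, 2, 3} : Finset ℕ).card) = 3 from rfl]
        push_cast
        linarith

/-- The event that `xy` is an edge whose curvature does not exist or violates `Q`. -/
def badEdge (x y : V) (Q : ℝ → Prop) : Set (SimpleGraph V) :=
  {G | G.Adj x y ∧ ¬ ∃ k, HasRicciCurvature G x y k ∧ Q k}

/-- Edges between sets of `s ≈ 7 L / p` vertices give the estimate `κ ≈ p`. -/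
lemma badEdge_dense_le (hxy : x ≠ y) (hL : 1 ≤ L) (hcard : (Fintype.card V : ℝ) = Real.exp L)
    (hd : 256 * L ≤ Fintype.card V * (p : ℝ)) :
    (SimpleGraph.binomialRandom V p).real (badEdge x y fun k => |k - p| ≤
      144 * √(L / (Fintype.card V * p)) + 128 * (L / (Fintype.card V * (p : ℝ) ^ 2))) ≤
      10 * Real.exp (-(5 * L)) := by
  set n : ℝ := (Fintype.card V : ℝ) with hn
  have hsc := scale_sqrt (p := p) hL hd
  have hd0 := hsc.d_pos
  have hn0 : 0 < n := hcard ▸ Real.exp_pos L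
  have hp0 : 0 < (p : ℝ) := pos_of_mul_pos_right hd0 hn0.le
  set s := ⌈7 * L / (p : ℝ)⌉₊ with hs
  have hs1 : 1 ≤ s := Nat.one_le_ceil_iff.2 (by positivity)
  have hsl : 7 * L ≤ p * s := by
    have := Nat.le_ceil (7 * L / (p : ℝ))
    rw [div_le_iff₀ hp0] at this
    linarith
  have hsu : (s : ℝ) ≤ 8 * L / p := by
    have h1 := Nat.ceil_lt_add_one (a := 7 * L / (p : ℝ)) (by positivity)
    have h2 : 1 ≤ L / p := by
      rw [le_div_iff₀ hp0]; linarith [p.2.2]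
    have e : 8 * L / p = 7 * L / p + L / p := by ring
    linarith
  have hexp := not_edgeExpanding_le (p := p) hs1 (by linarith) hcard hsl
  have htyp := not_typical_le (p := p) hxy hL hcard hd
  refine (measureReal_mono ?_).trans ((measureReal_union_le _ _).trans
    ((add_le_add htyp hexp).trans (by linarith [Real.exp_pos (-(5 * L))])))
  rintro G ⟨hadj, hG⟩
  by_contra hcon
  simp only [Set.mem_union, Set.mem_ofPred_eq, not_or, not_not] at hcon
  obtain ⟨k, hk, hkb⟩ := hcon.1.curvature_edgeExpanding hsc hadj hcon.2
  refine hG ⟨k, hk, hkb.trans ?_⟩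
  rw [sqrt_mul_div_self hd0]
  have : 16 * (s / (n * p)) ≤ 128 * (L / (n * (p : ℝ) ^ 2)) := by
    have e : 128 * (L / (n * (p : ℝ) ^ 2)) = 16 * ((8 * L / p) / (n * p)) := by
      field_simp
      ring
    rw [e]
    gcongr
  linarith

/-- Paths of length two between sets of `s ≈ 56 L / (n p²)` vertices give the estimate `κ ≈ -1`. -/
lemma badEdge_path_le (hxy : x ≠ y) (hL : 1 ≤ L) (hcard : (Fintype.card V : ℝ) = Real.exp L)
    (hd : 256 * L ≤ Fintype.card V * (p : ℝ)) (hnp : Fintype.card V * (p : ℝ) ^ 2 ≤ 1) :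
    (SimpleGraph.binomialRandom V p).real (badEdge x y fun k => |k - (-1)| ≤
      1040 * (Fintype.card V * (p : ℝ) ^ 2 + L / ((Fintype.card V : ℝ) ^ 2 * (p : ℝ) ^ 3))) ≤
      10 * Real.exp (-(5 * L)) := by
  set n : ℝ := (Fintype.card V : ℝ) with hn
  have hsc := scale_sqrt (p := p) hL hd
  have hd0 := hsc.d_pos
  have hn0 : 0 < n := hcard ▸ Real.exp_pos L
  have hp0 : 0 < (p : ℝ) := pos_of_mul_pos_right hd0 hn0.le
  have hnp0 : 0 < n * (p : ℝ) ^ 2 := by positivity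
  set s := ⌈56 * L / (n * (p : ℝ) ^ 2)⌉₊ with hs
  have hs1 : 1 ≤ s := Nat.one_le_ceil_iff.2 (by positivity)
  have hsl : 56 * L ≤ n * (p : ℝ) ^ 2 * s := by
    have := Nat.le_ceil (56 * L / (n * (p : ℝ) ^ 2))
    rw [div_le_iff₀ hnp0] at this
    linarith
  have hsu : (s : ℝ) ≤ 57 * L / (n * (p : ℝ) ^ 2) := by
    have h1 := Nat.ceil_lt_add_one (a := 56 * L / (n * (p : ℝ) ^ 2)) (by positivity)
    have h2 : 1 ≤ L / (n * (p : ℝ) ^ 2) := by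
      rw [le_div_iff₀ hnp0]; linarith
    have e : 57 * L / (n * (p : ℝ) ^ 2) = 56 * L / (n * (p : ℝ) ^ 2) + L / (n * (p : ℝ) ^ 2) := by
      ring
    linarith
  have hsp : s * (p : ℝ) ≤ 1 := by
    refine (mul_le_mul_of_nonneg_right hsu hp0.le).trans ?_
    rw [div_mul_eq_mul_div, div_le_one hnp0]
    nlinarith
  have hsn : 4 * (s : ℝ) ≤ n := by
    have h1 : 4 ≤ n * p := by linarith
    nlinarith
  have hexp := not_pathExpanding_le (p := p) hs1 (by linarith) hcard hsp hsn hsl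
  have htyp := not_typical_le (p := p) hxy hL hcard hd
  refine (measureReal_mono ?_).trans ((measureReal_union_le _ _).trans
    ((add_le_add htyp hexp).trans (by linarith [Real.exp_pos (-(5 * L))])))
  rintro G ⟨hadj, hG⟩
  by_contra hcon
  simp only [Set.mem_union, Set.mem_ofPred_eq, not_or, not_not] at hcon
  obtain ⟨k, hk, hkb⟩ := hcon.1.curvature_pathExpanding hsc hadj hcon.2
  refine hG ⟨k, hk, hkb.trans ?_⟩
  rw [sqrt_mul_div_self hd0]
  set a := n * (p : ℝ) ^ 2 with ha
  set b := L / (n ^ 2 * (p : ℝ) ^ 3) with hb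
  have hb0 : 0 ≤ b := by positivity
  -- the degree fluctuation is the geometric mean of the two error terms
  have hab : √(L / (n * p)) ≤ a + b := by
    have e : L / (n * p) = a * b := by
      rw [ha, hb]
      field_simp
    rw [e]
    exact Real.sqrt_le_iff.2 ⟨by positivity, by nlinarith⟩
  have hsb : 16 * (s / (n * p)) ≤ 912 * b := by
    have e : 912 * b = 16 * ((57 * L / (n * (p : ℝ) ^ 2)) / (n * p)) := by
      rw [hb]
      field_simp
      ring
    rw [e]
    gcongr
  have hpa : n * p * p = a := by rw [ha]; ring
  rw [hpa]
  linarith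

/-- No expansion is needed here: the lower bound `κ ≥ -2` holds for every edge. -/
lemma badEdge_sparse_le (hxy : x ≠ y) (hL : 1 ≤ L) (hcard : (Fintype.card V : ℝ) = Real.exp L)
    (hd : 256 * L ≤ Fintype.card V * (p : ℝ)) :
    (SimpleGraph.binomialRandom V p).real (badEdge x y fun k => |k - (-2)| ≤
      270 * ((Fintype.card V : ℝ) ^ 2 * (p : ℝ) ^ 3 + √(L / (Fintype.card V * p)))) ≤
      10 * Real.exp (-(5 * L)) := by
  have hsc := scale_sqrt (p := p) hL hd
  refine (measureReal_mono ?_).trans ((not_typical_le (p := p) hxy hL hcard hd).trans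
    (by linarith [Real.exp_pos (-(5 * L))]))
  rintro G ⟨hadj, hG⟩ htyp
  obtain ⟨k, hk, hkb⟩ := htyp.curvature_sparse hsc hadj
  refine hG ⟨k, hk, hkb.trans ?_⟩
  rw [sqrt_mul_div_self hsc.d_pos]
  have e : (Fintype.card V * (p : ℝ)) ^ 2 * p = (Fintype.card V : ℝ) ^ 2 * (p : ℝ) ^ 3 := by ring
  rw [e]
  linarith [Real.sqrt_nonneg (L / (Fintype.card V * (p : ℝ)))]

end Typical

/-- If every pair fails to be a good edge with probability `O(n ^ (-5))` and `p ≥ 1 / n`, then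
almost surely all edges are good: sum over all pairs for the first assertion, and divide by `p` for
the second. -/
lemma edgeCurvatureAlmostSurely_of_badEdge {p : ℕ → unitInterval} {Q : ℕ → ℝ → Prop}
    (h : ∀ᶠ n : ℕ in atTop, 1 ≤ Real.log n ∧ 256 * Real.log n ≤ n * (p n : ℝ) ∧
      ∀ x y : Fin n, x ≠ y → (SimpleGraph.binomialRandom (Fin n) (p n)).real
        (badEdge x y (Q n)) ≤ 10 * Real.exp (-(5 * Real.log n))) :
    EdgeCurvatureAlmostSurely p Q := by
  have hlim : Tendsto (fun n : ℕ => (10 : ℝ) / n) atTop (𝓝 0) :=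
    tendsto_const_div_atTop_nhds_zero_nat 10
  have hexp : ∀ n : ℕ, 1 ≤ n → Real.exp (-(5 * Real.log n)) = 1 / (n : ℝ) ^ 5 := by
    intro n hn
    have h0 : (0 : ℝ) < n := by exact_mod_cast hn
    rw [Real.exp_neg, mul_comm, Real.exp_mul, Real.exp_log h0, one_div]
    norm_cast
  constructor
  · have hlow : ∀ᶠ n : ℕ in atTop, 1 - (10 : ℝ) / n ≤
        (SimpleGraph.binomialRandom (Fin n) (p n)).real
          {G | ∀ x y : Fin n, G.Adj x y → G ∈ curvatureEvent (Q n) x y} := by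
      filter_upwards [h, eventually_ge_atTop 1] with n hn hn1
      obtain ⟨-, -, hb⟩ := hn
      rw [hexp n hn1] at hb
      have h1 : (1 : ℝ) ≤ n := by exact_mod_cast hn1
      set μ := SimpleGraph.binomialRandom (Fin n) (p n)
      set A : Set (SimpleGraph (Fin n)) :=
        {G | ∀ x y : Fin n, G.Adj x y → G ∈ curvatureEvent (Q n) x y} with hA
      have hpair : ∀ q : Fin n × Fin n,
          μ.real (badEdge q.1 q.2 (Q n)) ≤ 10 * (1 / (n : ℝ) ^ 5) := by
        rintro ⟨x, y⟩
        by_cases hxy : x = y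
        · subst hxy
          have : badEdge x x (Q n) = (∅ : Set (SimpleGraph (Fin n))) := by
            ext G; simp [badEdge]
          rw [this, measureReal_empty]
          positivity
        · exact hb x y hxy
      have hcompl : μ.real Aᶜ ≤ 10 / n := by
        calc μ.real Aᶜ ≤ μ.real (⋃ q : Fin n × Fin n, badEdge q.1 q.2 (Q n)) := by
              refine measureReal_mono fun G hG => ?_
              simp only [hA, Set.mem_compl_iff, Set.mem_ofPred_eq, not_forall] at hG
              obtain ⟨x, y, hxy, hbad⟩ := hG
              exact Set.mem_iUnion.2 ⟨(x, y), hxy, hbad⟩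
          _ ≤ ∑ q : Fin n × Fin n, μ.real (badEdge q.1 q.2 (Q n)) :=
              measureReal_iUnion_fintype_le _
          _ ≤ ∑ _q : Fin n × Fin n, 10 * (1 / (n : ℝ) ^ 5) := Finset.sum_le_sum fun q _ => hpair q
          _ = 10 / (n : ℝ) ^ 3 := by
              rw [Finset.sum_const, Finset.card_univ, Fintype.card_prod, Fintype.card_fin,
                nsmul_eq_mul]
              push_cast
              field_simp
          _ ≤ 10 / n := by
              gcongr
              exact le_self_pow₀ h1 (by norm_num)
      rw [probReal_compl_eq_one_sub (measurableSet_simpleGraph A)] at hcompl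
      linarith
    refine tendsto_of_tendsto_of_tendsto_of_le_of_le' (g := fun n : ℕ => 1 - (10 : ℝ) / n)
      (h := fun _ => 1) ?_ tendsto_const_nhds hlow (Eventually.of_forall fun n => measureReal_le_one)
    simpa using tendsto_const_nhds.sub hlim
  · intro ε hε
    filter_upwards [h, eventually_ge_atTop 1, hlim.eventually_lt_const hε] with n hn hn1 hnε x y hxy
    obtain ⟨hL, hd, hb⟩ := hn
    rw [hexp n hn1] at hb
    have h1 : (1 : ℝ) ≤ n := by exact_mod_cast hn1
    have hnp : 1 ≤ n * (p n : ℝ) := by linarith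
    have hp0 : (0 : ℝ) < p n := pos_of_mul_pos_right (a := (n : ℝ)) (by linarith) (by linarith)
    set μ := SimpleGraph.binomialRandom (Fin n) (p n)
    set S : Set (SimpleGraph (Fin n)) := {G | G.Adj x y} with hS
    have hSp : μ.real S = p n := by
      have := binomialRandom_real_mem_edgeSet (p := p n) (e := s(x, y))
        (by rw [Sym2.mk_isDiag_iff]; exact hxy)
      simpa using this
    have hsplit : μ.real S ≤ μ.real (S ∩ curvatureEvent (Q n) x y) +
        μ.real (badEdge x y (Q n)) := by
      refine (measureReal_mono fun G hG => ?_).trans (measureReal_union_le _ _)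
      by_cases hc : G ∈ curvatureEvent (Q n) x y
      · exact Or.inl ⟨hG, hc⟩
      · exact Or.inr ⟨hG, hc⟩
    rw [measureReal_def, cond_apply (measurableSet_simpleGraph S), ENNReal.toReal_mul,
      ENNReal.toReal_inv, ← measureReal_def, ← measureReal_def, hSp, inv_mul_eq_div, le_div_iff₀ hp0]
    have hbad : μ.real (badEdge x y (Q n)) ≤ ε * p n := by
      refine (hb x y hxy).trans ?_
      have h2 : 10 * (1 / (n : ℝ) ^ 5) ≤ 10 / n * (1 / n) := by
        rw [div_mul_div_comm, mul_one_div, ← sq]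
        have h5 : (n : ℝ) ^ 2 ≤ (n : ℝ) ^ 5 := pow_le_pow_right₀ h1 (by norm_num)
        rw [mul_one]
        gcongr
      have h3 : 1 / (n : ℝ) ≤ p n := by
        rw [div_le_iff₀ (by linarith), mul_comm]; exact hnp
      exact h2.trans (mul_le_mul hnε.le h3 (by positivity) hε.le)
    rw [hSp] at hsplit
    linarith

/-! ### The regimes -/

lemma EdgeCurvatureAlmostSurely.mono {p : ℕ → unitInterval} {Q R : ℕ → ℝ → Prop}
    (h : EdgeCurvatureAlmostSurely p Q) (hQR : ∀ᶠ n in atTop, ∀ k, Q n k → R n k) :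
    EdgeCurvatureAlmostSurely p R := by
  have hsub : ∀ n, (∀ k, Q n k → R n k) → ∀ x y : Fin n,
      curvatureEvent (Q n) x y ⊆ curvatureEvent (R n) x y := by
    rintro n hn x y G ⟨k, hk, hq⟩
    exact ⟨k, hk, hn k hq⟩
  refine ⟨tendsto_of_tendsto_of_tendsto_of_le_of_le' h.1 tendsto_const_nhds ?_
    (Eventually.of_forall fun n => measureReal_le_one), fun ε hε => ?_⟩
  · filter_upwards [hQR] with n hn
    exact measureReal_mono fun G hG x y hxy => hsub n hn x y (hG x y hxy)
  · filter_upwards [hQR, h.2 ε hε] with n hn hn2 x y hxy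
    exact (hn2 x y hxy).trans (measureReal_mono (hsub n hn x y))

lemma rpow_third_pow {a : ℝ} (ha : 0 ≤ a) : (a ^ (1 / 3 : ℝ)) ^ 3 = a := by
  rw [← Real.rpow_natCast, ← Real.rpow_mul ha]
  norm_num

lemma le_pow_three_of_rpow_third_le {a b : ℝ} (ha : 0 ≤ a) (h : a ^ (1 / 3 : ℝ) ≤ b) :
    a ≤ b ^ 3 := by
  rw [← rpow_third_pow ha]
  gcongr

lemma pow_three_le_of_lt_rpow_third {a b : ℝ} (ha : 0 ≤ a) (hb : 0 ≤ b)
    (h : b < a ^ (1 / 3 : ℝ)) : b ^ 3 ≤ a := by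
  rw [← rpow_third_pow ha]
  gcongr

lemma eventually_one_le_log : ∀ᶠ n : ℕ in atTop, 1 ≤ Real.log n :=
  (Real.tendsto_log_atTop.comp tendsto_natCast_atTop_atTop).eventually_ge_atTop 1

lemma eventually_log_sq_le (c : ℝ) : ∀ᶠ n : ℕ in atTop, c * Real.log n ^ 2 ≤ n := by
  have h : Tendsto (fun n : ℕ => Real.log n ^ 2 / n) atTop (𝓝 0) :=
    ((Real.isLittleO_pow_log_id_atTop (n := 2)).tendsto_div_nhds_zero).comp tendsto_natCast_atTop_atTop
  have h2 : Tendsto (fun n : ℕ => c * (Real.log n ^ 2 / n)) atTop (𝓝 0) := by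
    simpa using h.const_mul c
  filter_upwards [h2.eventually_le_const zero_lt_one, eventually_gt_atTop 0] with n hn hn0
  have h0 : (0 : ℝ) < n := by exact_mod_cast hn0
  rwa [← mul_div_assoc, div_le_one h0] at hn

lemma edgeCurvature_dense {p : ℕ → unitInterval}
    (hd : ∀ᶠ n : ℕ in atTop, 256 * Real.log n ≤ n * (p n : ℝ)) :
    EdgeCurvatureAlmostSurely p fun n k => |k - p n| ≤
      144 * √(Real.log n / (n * p n)) + 128 * (Real.log n / (n * (p n : ℝ) ^ 2)) := by
  refine edgeCurvatureAlmostSurely_of_badEdge ?_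
  filter_upwards [hd, eventually_one_le_log, eventually_gt_atTop 0] with n hn hL hn0
  refine ⟨hL, hn, fun x y hxy => ?_⟩
  have h0 : (0 : ℝ) < n := by exact_mod_cast hn0
  have := badEdge_dense_le (p := p n) hxy hL (by rw [Fintype.card_fin, Real.exp_log h0])
    (by rwa [Fintype.card_fin])
  rwa [Fintype.card_fin] at this

lemma edgeCurvature_path {p : ℕ → unitInterval}
    (hd : ∀ᶠ n : ℕ in atTop, 256 * Real.log n ≤ n * (p n : ℝ))
    (hp : ∀ᶠ n : ℕ in atTop, n * (p n : ℝ) ^ 2 ≤ 1) :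
    EdgeCurvatureAlmostSurely p fun n k => |k - (-1)| ≤
      1040 * (n * (p n : ℝ) ^ 2 + Real.log n / ((n : ℝ) ^ 2 * (p n : ℝ) ^ 3)) := by
  refine edgeCurvatureAlmostSurely_of_badEdge ?_
  filter_upwards [hd, hp, eventually_one_le_log, eventually_gt_atTop 0] with n hn hnp hL hn0
  refine ⟨hL, hn, fun x y hxy => ?_⟩
  have h0 : (0 : ℝ) < n := by exact_mod_cast hn0
  have := badEdge_path_le (p := p n) hxy hL (by rw [Fintype.card_fin, Real.exp_log h0])
    (by rwa [Fintype.card_fin]) (by rwa [Fintype.card_fin])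
  rwa [Fintype.card_fin] at this

lemma edgeCurvature_sparse {p : ℕ → unitInterval}
    (hd : ∀ᶠ n : ℕ in atTop, 256 * Real.log n ≤ n * (p n : ℝ)) :
    EdgeCurvatureAlmostSurely p fun n k => |k - (-2)| ≤
      270 * ((n : ℝ) ^ 2 * (p n : ℝ) ^ 3 + √(Real.log n / (n * p n))) := by
  refine edgeCurvatureAlmostSurely_of_badEdge ?_
  filter_upwards [hd, eventually_one_le_log, eventually_gt_atTop 0] with n hn hL hn0
  refine ⟨hL, hn, fun x y hxy => ?_⟩
  have h0 : (0 : ℝ) < n := by exact_mod_cast hn0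
  have := badEdge_sparse_le (p := p n) hxy hL (by rw [Fintype.card_fin, Real.exp_log h0])
    (by rwa [Fintype.card_fin])
  rwa [Fintype.card_fin] at this

/-- The curvature estimate for `p ≥ (ln n / n)^{1/3}`, where the matching error `ln n / (n p²)`
is dominated by the degree fluctuations. -/
lemma edgeCurvature_of_ge {p : ℕ → unitInterval}
    (hp : ∀ᶠ n : ℕ in atTop, (Real.log n / n) ^ (1 / 3 : ℝ) ≤ (p n : ℝ)) :
    EdgeCurvatureAlmostSurely p fun n k =>
      |k - (p n : ℝ)| ≤ 272 * √(Real.log n / (n * (p n : ℝ))) := by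
  have hcube : ∀ᶠ n : ℕ in atTop, Real.log n ≤ n * (p n : ℝ) ^ 3 := by
    filter_upwards [hp, eventually_one_le_log, eventually_gt_atTop 0] with n hn hL hn0
    have h0 : (0 : ℝ) < n := by exact_mod_cast hn0
    have h1 := le_pow_three_of_rpow_third_le (by positivity) hn
    rwa [div_le_iff₀ h0, mul_comm] at h1
  refine (edgeCurvature_dense ?_).mono ?_
  · filter_upwards [hcube, eventually_log_sq_le (256 ^ 3), eventually_one_le_log,
      eventually_gt_atTop 0] with n hn hlog hL hn0
    have h0 : (1 : ℝ) ≤ n := by exact_mod_cast hn0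
    have hp0 : (0 : ℝ) ≤ p n := (p n).2.1
    refine le_of_pow_le_pow_left₀ (n := 3) (by norm_num) (mul_nonneg (by linarith) (p n).2.1) ?_
    calc (256 * Real.log n) ^ 3 = Real.log n * (256 ^ 3 * Real.log n ^ 2) := by ring
      _ ≤ (n * (p n : ℝ) ^ 3) * n := mul_le_mul hn hlog (by positivity) (by positivity)
      _ = n ^ 2 * (p n : ℝ) ^ 3 := by ring
      _ ≤ n ^ 3 * (p n : ℝ) ^ 3 := by
          gcongr
          norm_num
      _ = _ := by ring
  · filter_upwards [hcube, eventually_one_le_log, eventually_gt_atTop 0] with n hn hL hn0 k hk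
    have h0 : (0 : ℝ) < n := by exact_mod_cast hn0
    have hp3 : 0 < (p n : ℝ) ^ 3 := pos_of_mul_pos_right (by linarith) h0.le
    have hp0 : 0 < (p n : ℝ) := by
      rcases (p n).2.1.eq_or_lt with h | h
      · rw [← h] at hp3; norm_num at hp3
      · exact h
    have hle : Real.log n / (n * (p n : ℝ) ^ 2) ≤ √(Real.log n / (n * (p n : ℝ))) := by
      refine Real.le_sqrt_of_sq_le ?_
      have e : (Real.log n / (n * (p n : ℝ) ^ 2)) ^ 2 =
          Real.log n / (n * (p n : ℝ)) * (Real.log n / (n * (p n : ℝ) ^ 3)) := by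
        field_simp
      rw [e]
      refine mul_le_of_le_one_right (by positivity) ?_
      rw [div_le_one (by positivity)]
      exact hn
    linarith

lemma edgeCurvature_little_o {p : ℕ → unitInterval}
    (hp : (fun n : ℕ => (Real.log n / n) ^ (1 / 3 : ℝ)) =o[atTop] (fun n : ℕ => (p n : ℝ))) :
    ∃ ε : ℕ → ℝ, Tendsto ε atTop (𝓝 0) ∧ EdgeCurvatureAlmostSurely p (fun n k =>
      |k - (p n : ℝ)| ≤ ε n * (p n : ℝ)) := by
  have hle : ∀ᶠ n : ℕ in atTop, (Real.log n / n) ^ (1 / 3 : ℝ) ≤ (p n : ℝ) := by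
    filter_upwards [hp.bound zero_lt_one] with n hn
    rw [one_mul, Real.norm_of_nonneg (p n).2.1] at hn
    exact (le_abs_self _).trans hn
  have hpos : ∀ᶠ n : ℕ in atTop, 0 < (p n : ℝ) := by
    filter_upwards [hle, eventually_one_le_log, eventually_gt_atTop 0] with n hn hL hn0
    have h0 : (0 : ℝ) < n := by exact_mod_cast hn0
    exact lt_of_lt_of_le (by positivity) hn
  -- `ε = 272 √(ρ³)`, where `ρ = (ln n / n)^{1/3} / p` tends to `0`
  refine ⟨fun n => 272 * √(((Real.log n / n) ^ (1 / 3 : ℝ) / p n) ^ 3), ?_, ?_⟩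
  · have h := ((hp.tendsto_div_nhds_zero.pow 3).sqrt).const_mul 272
    simpa using h
  · refine (edgeCurvature_of_ge hle).mono ?_
    filter_upwards [hpos, eventually_one_le_log, eventually_gt_atTop 0] with n hp0 hL hn0 k hk
    have h0 : (0 : ℝ) < n := by exact_mod_cast hn0
    refine hk.trans (le_of_eq ?_)
    rw [div_pow, rpow_third_pow (by positivity), mul_assoc]
    congr 1
    have e : Real.log n / (n * (p n : ℝ)) =
        Real.log n / n / (p n : ℝ) ^ 3 * (p n : ℝ) ^ 2 := by field_simp
    rw [e, Real.sqrt_mul (by positivity), Real.sqrt_sq hp0.le]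

/-- The curvature estimate for `(ln n / n)^{1/3} > p ≥ 2 (ln n / n)^{1/2}`, where both `p` and the
degree fluctuations are dominated by the matching error `ln n / (n p²)`. -/
lemma edgeCurvature_of_lt {p : ℕ → unitInterval}
    (hup : ∀ᶠ n : ℕ in atTop, (p n : ℝ) < (Real.log n / n) ^ (1 / 3 : ℝ))
    (hlow : ∀ᶠ n : ℕ in atTop, 2 * √(Real.log n / n) ≤ (p n : ℝ)) :
    EdgeCurvatureAlmostSurely p fun n k =>
      |k| ≤ 273 * (Real.log n / (n * (p n : ℝ) ^ 2)) := by
  refine (edgeCurvature_dense ?_).mono ?_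
  · filter_upwards [hlow, eventually_log_sq_le (128 ^ 2), eventually_one_le_log,
      eventually_gt_atTop 0] with n hn hlog hL hn0
    have h0 : (0 : ℝ) < n := by exact_mod_cast hn0
    have h1 : 128 * Real.log n ≤ n * √(Real.log n / n) := by
      have e : (n : ℝ) * √(Real.log n / n) = √(n * Real.log n) := by
        have : (n : ℝ) * Real.log n = n ^ 2 * (Real.log n / n) := by field_simp
        rw [this, Real.sqrt_mul (by positivity), Real.sqrt_sq h0.le]
      rw [e]
      refine Real.le_sqrt_of_sq_le ?_
      nlinarith
    nlinarith
  · filter_upwards [hup, hlow, eventually_one_le_log, eventually_gt_atTop 0]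
      with n hn hnl hL hn0 k hk
    have h0 : (0 : ℝ) < n := by exact_mod_cast hn0
    have hp0 : 0 < (p n : ℝ) := lt_of_lt_of_le (by positivity) hnl
    have hcube := pow_three_le_of_lt_rpow_third (by positivity) hp0.le hn
    rw [le_div_iff₀ h0] at hcube
    have h1 : (p n : ℝ) ≤ Real.log n / (n * (p n : ℝ) ^ 2) := by
      rw [le_div_iff₀ (by positivity)]
      linarith
    have h2 : √(Real.log n / (n * (p n : ℝ))) ≤ Real.log n / (n * (p n : ℝ) ^ 2) := by
      refine Real.sqrt_le_iff.2 ⟨by positivity, ?_⟩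
      have e : (Real.log n / (n * (p n : ℝ) ^ 2)) ^ 2 =
          Real.log n / (n * (p n : ℝ)) * (Real.log n / (n * (p n : ℝ) ^ 3)) := by
        field_simp
      rw [e]
      refine le_mul_of_one_le_right (by positivity) ?_
      rw [one_le_div (by positivity)]
      linarith
    have h3 := abs_le.1 hk
    exact abs_le.2 ⟨by linarith, by linarith⟩

end GraphCurvature

theorem mainTheorem8 :
    -- Regime 1: `p ≥ (ln n / n)^{1/3}`
    (∃ C : ℝ, 0 < C ∧ ∀ p : ℕ → unitInterval,
      (∀ᶠ n : ℕ in atTop, (Real.log n / n) ^ (1 / 3 : ℝ) ≤ (p n : ℝ)) →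
      GraphCurvature.EdgeCurvatureAlmostSurely p (fun n k =>
        |k - (p n : ℝ)| ≤ C * √(Real.log n / (n * (p n : ℝ))))) ∧
    -- In particular, for `p ≫ (ln n / n)^{1/3}`: `κ = (1 + o(1)) p`
    (∀ p : ℕ → unitInterval,
      (fun n : ℕ => (Real.log n / n) ^ (1 / 3 : ℝ)) =o[atTop] (fun n : ℕ => (p n : ℝ)) →
      ∃ ε : ℕ → ℝ, Tendsto ε atTop (𝓝 0) ∧
        GraphCurvature.EdgeCurvatureAlmostSurely p (fun n k =>
          |k - (p n : ℝ)| ≤ ε n * (p n : ℝ))) ∧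
    -- Regime 2: `(ln n / n)^{1/3} > p ≥ 2 (ln n / n)^{1/2}`
    (∃ C : ℝ, 0 < C ∧ ∀ p : ℕ → unitInterval,
      (∀ᶠ n : ℕ in atTop, (p n : ℝ) < (Real.log n / n) ^ (1 / 3 : ℝ)) →
      (∀ᶠ n : ℕ in atTop, 2 * √(Real.log n / n) ≤ (p n : ℝ)) →
      GraphCurvature.EdgeCurvatureAlmostSurely p (fun n k =>
        |k| ≤ C * (Real.log n / (n * (p n : ℝ) ^ 2)))) ∧
    -- Regime 3: `n^{-1/2} ≫ p ≫ (ln n / n²)^{1/3}`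
    (∃ C : ℝ, 0 < C ∧ ∀ p : ℕ → unitInterval,
      (fun n : ℕ => (p n : ℝ)) =o[atTop] (fun n : ℕ => 1 / √(n : ℝ)) →
      (fun n : ℕ => (Real.log n / (n : ℝ) ^ 2) ^ (1 / 3 : ℝ)) =o[atTop]
        (fun n : ℕ => (p n : ℝ)) →
      GraphCurvature.EdgeCurvatureAlmostSurely p (fun n k =>
        |k - (-1)| ≤ C * (n * (p n : ℝ) ^ 2 + Real.log n / ((n : ℝ) ^ 2 * (p n : ℝ) ^ 3)))) ∧
    -- Regime 4: `n^{-2/3} ≫ p ≫ ln n / n`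
    (∃ C : ℝ, 0 < C ∧ ∀ p : ℕ → unitInterval,
      (fun n : ℕ => (p n : ℝ)) =o[atTop] (fun n : ℕ => (1 / (n : ℝ) ^ 2) ^ (1 / 3 : ℝ)) →
      (fun n : ℕ => Real.log n / n) =o[atTop] (fun n : ℕ => (p n : ℝ)) →
      GraphCurvature.EdgeCurvatureAlmostSurely p (fun n k =>
        |k - (-2)| ≤ C * ((n : ℝ) ^ 2 * (p n : ℝ) ^ 3 +
          √(Real.log n / (n * (p n : ℝ)))))) := by
  refine ⟨⟨272, by norm_num, fun p hp => GraphCurvature.edgeCurvature_of_ge hp⟩,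
    fun p hp => GraphCurvature.edgeCurvature_little_o hp,
    ⟨273, by norm_num, fun p hup hlow => GraphCurvature.edgeCurvature_of_lt hup hlow⟩,
    ⟨1040, by norm_num, fun p hup hlow => GraphCurvature.edgeCurvature_path ?_ ?_⟩,
    ⟨270, by norm_num, fun p _ hlow => GraphCurvature.edgeCurvature_sparse ?_⟩⟩
  · filter_upwards [hlow.bound zero_lt_one, GraphCurvature.eventually_log_sq_le (256 ^ 3),
      GraphCurvature.eventually_one_le_log, eventually_gt_atTop 0] with n hn hlog hL hn0
    have h0 : (0 : ℝ) < n := by exact_mod_cast hn0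
    rw [one_mul, Real.norm_of_nonneg (p n).2.1] at hn
    have h1 := GraphCurvature.le_pow_three_of_rpow_third_le (by positivity)
      ((le_abs_self _).trans hn)
    rw [div_le_iff₀ (by positivity)] at h1
    have hp0 : (0 : ℝ) ≤ p n := (p n).2.1
    refine le_of_pow_le_pow_left₀ (n := 3) (by norm_num) (mul_nonneg h0.le (p n).2.1) ?_
    calc (256 * Real.log n) ^ 3 = Real.log n * (256 ^ 3 * Real.log n ^ 2) := by ring
      _ ≤ ((p n : ℝ) ^ 3 * n ^ 2) * n := mul_le_mul h1 hlog (by positivity) (by positivity)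
      _ = _ := by ring
  · filter_upwards [hup.bound zero_lt_one, eventually_gt_atTop 0] with n hn hn0
    have h0 : (0 : ℝ) < n := by exact_mod_cast hn0
    rw [one_mul, Real.norm_of_nonneg (p n).2.1, Real.norm_of_nonneg (by positivity)] at hn
    have h1 := pow_le_pow_left₀ (p n).2.1 hn 2
    rw [div_pow, Real.sq_sqrt h0.le, one_pow, le_div_iff₀ h0] at h1
    linarith
  · filter_upwards [hlow.bound (show (0 : ℝ) < 1 / 256 by norm_num), eventually_gt_atTop 0]
      with n hn hn0
    have h0 : (0 : ℝ) < n := by exact_mod_cast hn0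
    rw [Real.norm_of_nonneg (p n).2.1] at hn
    have h1 := (le_abs_self _).trans hn
    rw [div_le_iff₀ h0] at h1
    linarith
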